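/- **Language.** Let $\mathcal L_{\mathbb N}$ be the language of arithmetic $0,S,+,\cdot$ with finitely many further function symbols for primitive recursive functions (pairing, binary digits, the numeral function $\mathrm{num}$, the syntactic operations $\underset{\cdot}{=},\underset{\cdot}{\neg},\underset{\cdot}{\wedge},\underset{\cdot}{\vee},\underset{\cdot}{\forall},\underset{\cdot}{\exists}$ on Gödel numbers, and substitution $x(t/v)$). Let $\mathcal L(P)$ add a schematic unary predicate $P$, and let $\mathcal L(P)_{\mathrm{Tr}}$ add to $\mathcal L(P)$ a unary predicate $\mathrm{Tr}$. The connectives are $\neg,\wedge,\vee$, with $\varphi\to\psi:=\neg\varphi\vee\psi$. $\mathrm{Var}$, $\mathrm{CT}$, $\mathrm{Sent}$ are arithmetical formulas defining the sets of codes of variables, closed terms and sentences of $\mathcal L(P)_{\mathrm{Tr}}$. $\mathrm{Ax}_{\mathrm{PAT}}$ is an arithmetical formula defining the set of codes of sentences that are universal generalizations of axioms of first-order logic with equality or of Peano arithmetic with induction for all formulas of $\mathcal L(P)_{\mathrm{Tr}}$. For closed terms, $x^\circ=y^\circ$ says that $x$ and $y$ have the same value. $\ulcorner\varphi(\dot x)\urcorner$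 is the result of substituting the numeral of $x$ for the free variable of $\varphi$ in $\ulcorner\varphi\urcorner$. **Theory.** $\mathrm{VFM}^*$ is the theory in $\mathcal L(P)_{\mathrm{Tr}}$ over classical first-order logic with equality whose axioms are the axioms of Peano arithmetic other than the induction scheme (including the defining axioms of the additional function symbols), the induction axiom $P(0)\wedge\forall x(P(x)\to P(Sx))\to\forall x\,P(x)$, and the universal closures of - (VF1) $\mathrm{CT}(x)\wedge\mathrm{CT}(y)\to[(\mathrm{Tr}(x\underset{\cdot}{=}y)\leftrightarrow x^\circ=y^\circ)\wedge(\mathrm{Tr}(x\underset{\cdot}{\neq}y)\leftrightarrow x^\circ\neq y^\circ)]$ - (VF2) $\mathrm{Ax}_{\mathrm{PAT}}(x)\to\mathrm{Tr}(x)$ - (VF3) $\mathrm{Var}(v)\to(\forall z\,\mathrm{Tr}(x(\mathrm{num}(z)/v))\to\mathrm{Tr}(\underset{\cdot}{\forall}v\,x))$ - (VF4) $\mathrm{Tr}(x)\leftrightarrow\mathrm{Tr}\ulcorner\mathrm{Tr}(\dot x)\urcorner$ - (VF5) $\mathrm{Sent}(x)\to(\mathrm{Tr}(\underset{\cdot}{\neg}\ulcorner\mathrm{Tr}(\dot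 x)\urcorner)\leftrightarrow\mathrm{Tr}(\underset{\cdot}{\neg}x))$ - (VF6) $\mathrm{Tr}(x\underset{\cdot}{\to}y)\to(\mathrm{Tr}(x)\to\mathrm{Tr}(y))$ - (VF7) $\mathrm{Sent}(x)\to\mathrm{Tr}\ulcorner\neg\mathrm{Tr}(\dot x)\leftrightarrow\mathrm{Tr}(\underset{\cdot}{\neg}\dot x)\urcorner$ - (VF8) $\mathrm{Tr}\ulcorner\mathrm{Tr}(\dot x)\to\mathrm{Sent}(\dot x)\urcorner$ - (P-Disq) $\mathrm{Tr}\ulcorner P(\dot x)\urcorner\leftrightarrow P(x)$ and which is closed under the rule P-Subst: from $A(P)$ infer $A(B/P)$, for $A$ a formula of $\mathcal L(P)$ and $B$ any formula of $\mathcal L(P)_{\mathrm{Tr}}$ (without capture of variables). **Models.** For $X,Y\subseteq\mathbb N$, $(\mathbb N,X,Y)$ is the standard model of arithmetic with $X$ as the extension of $P$ and $Y$ as the extension of $\mathrm{Tr}$. A set of codes of sentences of $\mathcal L(P)_{\mathrm{Tr}}$ is maximally consistent if it is inclusion-maximal among the sets of codes of sentences that are consistent in first-order logic with equality. For a sentence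 $\varphi$ write $X,Y\vDash_{mc*}\varphi$ if $(\mathbb N,X,Z)\vDash\varphi$ for all maximally consistent $Z\supseteq Y$. For $X\subseteq\mathbb N$ put ${}_X\Gamma_0=\varnothing$, ${}_X\Gamma_{\alpha+1}=\{\#\varphi\mid \varphi\text{ a sentence},\ X,{}_X\Gamma_\alpha\vDash_{mc*}\varphi\}$, and ${}_X\Gamma_\lambda=\bigcup_{\beta<\lambda}{}_X\Gamma_\beta$ for limit ordinals $\lambda$. **Statement.** For every $X\subseteq\mathbb N$ there is an ordinal $\alpha$ with ${}_X\Gamma_\alpha={}_X\Gamma_{\alpha+1}$, and for every such $\alpha$ and every formula $\varphi$ of $\mathcal L(P)_{\mathrm{Tr}}$, $$\mathrm{VFM}^*\vdash\varphi\ \Longrightarrow\ (\mathbb N,X,{}_X\Gamma_\alpha)\vDash\varphi$$ (for all values of the free variables of $\varphi$). Consequently $\mathrm{VFM}^*$ is consistent: there is no $\varphi$ with $\mathrm{VFM}^*\vdash\varphi$ and $\mathrm{VFM}^*\vdash\neg\varphi$. -/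

import Mathlib

namespace VFM

/-! ## The language

Arithmetic `0, S, +, ·` with finitely many further symbols for primitive recursive functions
(pairing, binary digits, numerals, the syntactic operations on codes, substitution), a schematic
unary predicate `P` and the truth predicate `Tr`. Variables are named by natural numbers. -/

/-- Unary function symbols: successor, `n ↦` code of the `n`-th numeral, negation of codes. -/
inductive Fn1 : Type
  | succ | num | neg

/-- Binary function symbols: sum, product, pairing, `bit x y` = the `y`-th binary digit of `x`,
and the operations on codes that form equations, conjunctions, disjunctions and quantifications
(the first argument of `all`, `ex` is the code of the bound variable). -/
inductive Fn2 : Type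
  | add | mul | pair | bit | eq | and | or | all | ex

/-- Terms; `sub x t v` is the symbol for substitution `x(t/v)` on codes. -/
inductive Term : Type
  | var (i : ℕ)
  | zero
  | app1 (f : Fn1) (t : Term)
  | app2 (f : Fn2) (s t : Term)
  | sub (x t v : Term)

inductive Formula : Type
  | eq (s t : Term)
  | tr (t : Term)
  | P (t : Term)
  | neg (φ : Formula)
  | and (φ ψ : Formula)
  | or (φ ψ : Formula)
  | all (v : ℕ) (φ : Formula)
  | ex (v : ℕ) (φ : Formula)

/-- `φ → ψ` abbreviates `¬φ ∨ ψ`. -/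
def Formula.imp (φ ψ : Formula) : Formula := .or (.neg φ) ψ

def Formula.iff (φ ψ : Formula) : Formula := .and (φ.imp ψ) (ψ.imp φ)

/-- Finite disjunctions and conjunctions (the empty ones are `0 = S0` and `0 = 0`). -/
def bigOr : List Formula → Formula
  | [] => .eq .zero (.app1 .succ .zero)
  | [φ] => φ
  | φ :: l => .or φ (bigOr l)

def bigAnd : List Formula → Formula
  | [] => .eq .zero .zero
  | [φ] => φ
  | φ :: l => .and φ (bigAnd l)

/-- The numeral of `n`. -/
def numeral : ℕ → Term
  | 0 => .zero
  | n + 1 => .app1 .succ (numeral n)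

/-! ## Variables and substitution -/

def Term.vars : Term → Finset ℕ
  | .var i => {i}
  | .zero => ∅
  | .app1 _ t => t.vars
  | .app2 _ s t => s.vars ∪ t.vars
  | .sub x t v => x.vars ∪ t.vars ∪ v.vars

/-- Free variables. -/
def Formula.fv : Formula → Finset ℕ
  | .eq s t => s.vars ∪ t.vars
  | .tr t => t.vars
  | .P t => t.vars
  | .neg φ => φ.fv
  | .and φ ψ => φ.fv ∪ ψ.fv
  | .or φ ψ => φ.fv ∪ ψ.fv
  | .all v φ => φ.fv.erase v
  | .ex v φ => φ.fv.erase v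

def Formula.IsSentence (φ : Formula) : Prop := φ.fv = ∅

/-- `s.subst u i` is `s(u/vᵢ)`. -/
def Term.subst (s u : Term) (i : ℕ) : Term :=
  match s with
  | .var j => if j = i then u else .var j
  | .zero => .zero
  | .app1 f t => .app1 f (t.subst u i)
  | .app2 f s t => .app2 f (s.subst u i) (t.subst u i)
  | .sub x t v => .sub (x.subst u i) (t.subst u i) (v.subst u i)

/-- Substitution of `u` for the free occurrences of `vᵢ`. -/
def Formula.subst (A : Formula) (u : Term) (i : ℕ) : Formula :=
  match A with
  | .eq s t => .eq (s.subst u i) (t.subst u i)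
  | .tr t => .tr (t.subst u i)
  | .P t => .P (t.subst u i)
  | .neg φ => .neg (φ.subst u i)
  | .and φ ψ => .and (φ.subst u i) (ψ.subst u i)
  | .or φ ψ => .or (φ.subst u i) (ψ.subst u i)
  | .all v φ => if v = i then .all v φ else .all v (φ.subst u i)
  | .ex v φ => if v = i then .ex v φ else .ex v (φ.subst u i)

/-- The term `u` is free for `vᵢ` in the formula `A`. -/
def Formula.FreeFor (A : Formula) (u : Term) (i : ℕ) : Prop :=
  match A with
  | .eq _ _ => True
  | .tr _ => True
  | .P _ => True
  | .neg φ => φ.FreeFor u i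
  | .and φ ψ => φ.FreeFor u i ∧ ψ.FreeFor u i
  | .or φ ψ => φ.FreeFor u i ∧ ψ.FreeFor u i
  | .all v φ => i ∉ φ.fv.erase v ∨ (v ∉ u.vars ∧ φ.FreeFor u i)
  | .ex v φ => i ∉ φ.fv.erase v ∨ (v ∉ u.vars ∧ φ.FreeFor u i)

/-- The formula belongs to `L(P)`: it does not contain `Tr`. -/
def Formula.TrFree : Formula → Prop
  | .eq _ _ => True
  | .tr _ => False
  | .P _ => True
  | .neg φ => φ.TrFree
  | .and φ ψ => φ.TrFree ∧ ψ.TrFree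
  | .or φ ψ => φ.TrFree ∧ ψ.TrFree
  | .all _ φ => φ.TrFree
  | .ex _ φ => φ.TrFree

/-- `A.substP B i` is `A(B/P)`: every `P(t)` in `A` is replaced by `B(t/vᵢ)`. -/
def Formula.substP (A B : Formula) (i : ℕ) : Formula :=
  match A with
  | .eq s t => .eq s t
  | .tr t => .tr t
  | .P t => B.subst t i
  | .neg φ => .neg (φ.substP B i)
  | .and φ ψ => .and (φ.substP B i) (ψ.substP B i)
  | .or φ ψ => .or (φ.substP B i) (ψ.substP B i)
  | .all v φ => .all v (φ.substP B i)
  | .ex v φ => .ex v (φ.substP B i)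

/-- No variable is captured in `A(B/P)`: in each `P(t)` the term `t` is free for `vᵢ` in `B`, and
the parameters of `B` are not bound in `A`. -/
def Formula.FreeForP (A B : Formula) (i : ℕ) : Prop :=
  match A with
  | .eq _ _ => True
  | .tr _ => True
  | .P t => B.FreeFor t i
  | .neg φ => φ.FreeForP B i
  | .and φ ψ => φ.FreeForP B i ∧ ψ.FreeForP B i
  | .or φ ψ => φ.FreeForP B i ∧ ψ.FreeForP B i
  | .all v φ => v ∉ B.fv.erase i ∧ φ.FreeForP B i
  | .ex v φ => v ∉ B.fv.erase i ∧ φ.FreeForP B i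

/-! ## Gödel numbers -/

def Fn1.tag : Fn1 → ℕ
  | .succ => 2
  | .num => 3
  | .neg => 4

def Fn2.tag : Fn2 → ℕ
  | .add => 5
  | .mul => 6
  | .pair => 7
  | .bit => 8
  | .eq => 9
  | .and => 10
  | .or => 11
  | .all => 12
  | .ex => 13

def codeVar (i : ℕ) : ℕ := Nat.pair 1 i

def Term.code : Term → ℕ
  | .var i => codeVar i
  | .zero => 0
  | .app1 f t => Nat.pair f.tag t.code
  | .app2 f s t => Nat.pair f.tag (Nat.pair s.code t.code)
  | .sub x t v => Nat.pair 14 (Nat.pair x.code (Nat.pair t.code v.code))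

def Formula.code : Formula → ℕ
  | .eq s t => Nat.pair 15 (Nat.pair s.code t.code)
  | .tr t => Nat.pair 16 t.code
  | .P t => Nat.pair 17 t.code
  | .neg φ => Nat.pair 18 φ.code
  | .and φ ψ => Nat.pair 19 (Nat.pair φ.code ψ.code)
  | .or φ ψ => Nat.pair 20 (Nat.pair φ.code ψ.code)
  | .all v φ => Nat.pair 21 (Nat.pair (codeVar v) φ.code)
  | .ex v φ => Nat.pair 22 (Nat.pair (codeVar v) φ.code)

/-- The set of codes of sentences. -/
def SentCodes : Set ℕ := {n | ∃ φ : Formula, φ.IsSentence ∧ φ.code = n}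

/-- Tags of the codes with one, with two immediate constituents, and of the quantifiers
(14 is the only tag with three constituents). -/
def tags1 : List ℕ := [2, 3, 4, 16, 17, 18]
def tags2 : List ℕ := [5, 6, 7, 8, 9, 10, 11, 12, 13, 15, 19, 20]
def tagsQ : List ℕ := [21, 22]

theorem lt_of_unpair {x : ℕ} (h : x.unpair.1 ≠ 0) : x.unpair.2 < x := by
  have h1 := Nat.pair_unpair x
  have h2 : x.unpair.1 + x.unpair.2 ≤ Nat.pair x.unpair.1 x.unpair.2 := Nat.add_le_pair _ _
  omega

/-- The substitution function on codes; `substCode t v x` is `x(t/v)`. It is total; numbers that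
are not codes are treated by the same recursion. -/
def substCode (t v : ℕ) (x : ℕ) : ℕ :=
  if x = v then t
  else if h1 : x.unpair.1 ∈ tags1 then
    have : x.unpair.2 < x := lt_of_unpair (by intro h; simp [h, tags1] at h1)
    Nat.pair x.unpair.1 (substCode t v x.unpair.2)
  else if h2 : x.unpair.1 ∈ tags2 then
    have : x.unpair.2 < x := lt_of_unpair (by intro h; simp [h, tags2] at h2)
    have := Nat.unpair_left_le x.unpair.2
    have := Nat.unpair_right_le x.unpair.2
    Nat.pair x.unpair.1
      (Nat.pair (substCode t v x.unpair.2.unpair.1) (substCode t v x.unpair.2.unpair.2))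
  else if h3 : x.unpair.1 = 14 then
    have : x.unpair.2 < x := lt_of_unpair (by omega)
    have := Nat.unpair_left_le x.unpair.2
    have := Nat.unpair_right_le x.unpair.2
    have := Nat.unpair_left_le x.unpair.2.unpair.2
    have := Nat.unpair_right_le x.unpair.2.unpair.2
    Nat.pair 14
      (Nat.pair (substCode t v x.unpair.2.unpair.1)
        (Nat.pair (substCode t v x.unpair.2.unpair.2.unpair.1)
          (substCode t v x.unpair.2.unpair.2.unpair.2)))
  else if h4 : x.unpair.1 ∈ tagsQ then
    have : x.unpair.2 < x := lt_of_unpair (by intro h; simp [h, tagsQ] at h4)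
    have := Nat.unpair_right_le x.unpair.2
    if x.unpair.2.unpair.1 = v then x
    else Nat.pair x.unpair.1
      (Nat.pair x.unpair.2.unpair.1 (substCode t v x.unpair.2.unpair.2))
  else x
termination_by x
decreasing_by all_goals omega

/-! ## The standard interpretation -/

def Fn1.interp : Fn1 → ℕ → ℕ
  | .succ, n => n + 1
  | .num, n => (numeral n).code
  | .neg, n => Nat.pair 18 n

def Fn2.interp : Fn2 → ℕ → ℕ → ℕ
  | .add, m, n => m + n
  | .mul, m, n => m * n
  | .pair, m, n => Nat.pair m n
  | .bit, m, n => (m.testBit n).toNat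
  | .eq, m, n => Nat.pair 15 (Nat.pair m n)
  | .and, m, n => Nat.pair 19 (Nat.pair m n)
  | .or, m, n => Nat.pair 20 (Nat.pair m n)
  | .all, m, n => Nat.pair 21 (Nat.pair m n)
  | .ex, m, n => Nat.pair 22 (Nat.pair m n)

/-- The value of a term under the assignment `e`. -/
def Term.val (e : ℕ → ℕ) : Term → ℕ
  | .var i => e i
  | .zero => 0
  | .app1 f t => f.interp (t.val e)
  | .app2 f s t => f.interp (s.val e) (t.val e)
  | .sub x t v => substCode (t.val e) (v.val e) (x.val e)

/-- `(ℕ, X, Y) ⊨ φ [e]`, where `X` interprets `P` and `Y` interprets `Tr`. -/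
def Formula.Sat (X Y : Set ℕ) : (ℕ → ℕ) → Formula → Prop
  | e, .eq s t => s.val e = t.val e
  | e, .tr t => t.val e ∈ Y
  | e, .P t => t.val e ∈ X
  | e, .neg φ => ¬ φ.Sat X Y e
  | e, .and φ ψ => φ.Sat X Y e ∧ ψ.Sat X Y e
  | e, .or φ ψ => φ.Sat X Y e ∨ ψ.Sat X Y e
  | e, .all v φ => ∀ n, φ.Sat X Y (Function.update e v n)
  | e, .ex v φ => ∃ n, φ.Sat X Y (Function.update e v n)

/-- `(ℕ, X, Y) ⊨ φ` (for all values of the free variables, if any). -/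
def Models (X Y : Set ℕ) (φ : Formula) : Prop := ∀ e : ℕ → ℕ, φ.Sat X Y e

/-! ## First-order logic with equality -/

/-- Axiom schemes of classical propositional logic, for any operations in the role of the
connectives: applied below both to formulas and to terms denoting codes of formulas. -/
def propAxioms {α : Type} (neg : α → α) (and or : α → α → α) (a b c : α) : List α :=
  let imp : α → α → α := fun x y => or (neg x) y
  [ imp a (imp b a),
    imp (imp a (imp b c)) (imp (imp a b) (imp a c)),
    imp (and a b) a,
    imp (and a b) b,
    imp a (imp b (and a b)),
    imp a (or a b),
    imp b (or a b),
    imp (imp a c) (imp (imp b c) (imp (or a b) c)),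
    imp (imp a b) (imp (imp a (neg b)) (neg a)),
    imp (neg (neg a)) a ]

inductive LogAx : Formula → Prop
  | prop (A B C φ : Formula) (h : φ ∈ propAxioms Formula.neg Formula.and Formula.or A B C) :
      LogAx φ
  | allElim (A : Formula) (v : ℕ) (t : Term) (h : A.FreeFor t v) :
      LogAx ((Formula.all v A).imp (A.subst t v))
  | exIntro (A : Formula) (v : ℕ) (t : Term) (h : A.FreeFor t v) :
      LogAx ((A.subst t v).imp (Formula.ex v A))
  | allImp (A B : Formula) (v : ℕ) :
      LogAx ((Formula.all v (A.imp B)).imp ((Formula.all v A).imp (Formula.all v B)))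
  | allVac (A : Formula) (v : ℕ) (h : v ∉ A.fv) : LogAx (A.imp (Formula.all v A))
  | exElim (A B : Formula) (v : ℕ) (h : v ∉ B.fv) :
      LogAx ((Formula.all v (A.imp B)).imp ((Formula.ex v A).imp B))
  | eqRefl (t : Term) : LogAx (Formula.eq t t)
  | eqSubst (A : Formula) (v : ℕ) (s t : Term) (hs : A.FreeFor s v) (ht : A.FreeFor t v) :
      LogAx ((Formula.eq s t).imp ((A.subst s v).imp (A.subst t v)))

/-- Derivability in first-order logic with equality from a set `T` (used for sets of sentences). -/
inductive Derives (T : Set Formula) : Formula → Prop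
  | logic {φ} (h : LogAx φ) : Derives T φ
  | hyp {φ} (h : φ ∈ T) : Derives T φ
  | mp {φ ψ} (h1 : Derives T (φ.imp ψ)) (h2 : Derives T φ) : Derives T ψ
  | gen {φ} (v : ℕ) (h : Derives T φ) : Derives T (Formula.all v φ)

/-! ## Maximally consistent sets and the fixed-point construction -/

/-- `Z` is a consistent set of codes of sentences. -/
def IsConsistentSet (Z : Set ℕ) : Prop :=
  Z ⊆ SentCodes ∧
    ¬ ∃ φ : Formula, Derives {ψ | ψ.code ∈ Z} φ ∧ Derives {ψ | ψ.code ∈ Z} (.neg φ)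

/-- `Z` is a maximally consistent set of codes of sentences. -/
def MaxCons (Z : Set ℕ) : Prop := Maximal IsConsistentSet Z

/-- `(ℕ, X, Y) ⊨_mc φ`. -/
def SatMC (X Y : Set ℕ) (φ : Formula) : Prop := ∀ Z : Set ℕ, Y ⊆ Z → MaxCons Z → Models X Z φ

/-- The Kripke jump over the interpretation `X` of `P`. -/
def jump (X Y : Set ℕ) : Set ℕ := {n | ∃ φ : Formula, φ.IsSentence ∧ φ.code = n ∧ SatMC X Y φ}

/-- The transfinite iteration of the jump over `X`, starting with the empty set. -/
noncomputable def stage (X : Set ℕ) (α : Ordinal.{0}) : Set ℕ :=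
  Ordinal.limitRecOn (motive := fun _ => Set ℕ) α ∅ (fun _ Y => jump X Y)
    (fun l _ Y => ⋃ (β : Ordinal.{0}) (h : β < l), Y β h)

/-! ## Arithmetical formulas about codes

In the formulas below the bound variables are `v_k, v_{k+1}, …`; the terms that are put in for the
arguments must contain only variables with an index below `k`. -/

/-- Names for some terms. -/
def tPair (s t : Term) : Term := .app2 .pair s t
def tNeg (t : Term) : Term := .app1 .neg t
def tEq (s t : Term) : Term := .app2 .eq s t
def tAnd (s t : Term) : Term := .app2 .and s t
def tOr (s t : Term) : Term := .app2 .or s t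
def tImp (s t : Term) : Term := tOr (tNeg s) t
def tAll (s t : Term) : Term := .app2 .all s t
def tEx (s t : Term) : Term := .app2 .ex s t
def tSucc (t : Term) : Term := .app1 .succ t
def tOne : Term := tSucc .zero

/-- The Gödel numerals `⌜φ⌝` and `⌜v₀⌝`. -/
def quote (φ : Formula) : Term := numeral φ.code
def quoteVar0 : Term := numeral (codeVar 0)

/-- `⌜φ(ẋ)⌝`, for `φ` with the free variable `v₀`: the numeral of `x` is substituted for `v₀`. -/
def quoteDot (φ : Formula) (x : Term) : Term := .sub (quote φ) (.app1 .num x) quoteVar0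

/-- `y` is an element of the finite set with the binary expansion `s`. -/
def memF (s y : Term) : Formula := .eq (.app2 .bit s y) tOne

/-- `x` belongs to some finite set each of whose elements `y` satisfies `step s y`. -/
def closureF (k : ℕ) (x : Term) (step : Term → Term → Formula) : Formula :=
  .ex k (.and (memF (.var k) x)
    (.all (k + 1) ((memF (.var k) (.var (k + 1))).imp (step (.var k) (.var (k + 1))))))

/-- `y` has the given tag and one (two, three) immediate constituents, all of them in `s`. -/
def built1 (k : ℕ) (tag : ℕ) (s y : Term) : Formula :=
  .ex k (.and (memF s (.var k)) (.eq y (tPair (numeral tag) (.var k))))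

def built2 (k : ℕ) (tag : ℕ) (s y : Term) : Formula :=
  .ex k (.ex (k + 1) (bigAnd [memF s (.var k), memF s (.var (k + 1)),
    .eq y (tPair (numeral tag) (tPair (.var k) (.var (k + 1))))]))

def built3 (k : ℕ) (tag : ℕ) (s y : Term) : Formula :=
  .ex k (.ex (k + 1) (.ex (k + 2) (bigAnd [memF s (.var k), memF s (.var (k + 1)),
    memF s (.var (k + 2)),
    .eq y (tPair (numeral tag) (tPair (.var k) (tPair (.var (k + 1)) (.var (k + 2)))))])))

/-- `x` is the code of a variable. -/
def varF (k : ℕ) (x : Term) : Formula := .ex k (.eq x (tPair tOne (.var k)))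

def allFn1 : List Fn1 := [.succ, .num, .neg]
def allFn2 : List Fn2 := [.add, .mul, .pair, .bit, .eq, .and, .or, .all, .ex]

/-- One step in the formation of closed terms. -/
def closedTermStep (k : ℕ) (s y : Term) : Formula :=
  bigOr ([.eq y .zero] ++ allFn1.map (fun f => built1 k f.tag s y) ++
    allFn2.map (fun f => built2 k f.tag s y) ++ [built3 k 14 s y])

/-- `x` is the code of a closed term. -/
def ctF (k : ℕ) (x : Term) : Formula := closureF k x (closedTermStep (k + 2))

/-- `x` is the code of a term. -/
def termF (k : ℕ) (x : Term) : Formula :=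
  closureF k x (fun s y => .or (varF (k + 2) y) (closedTermStep (k + 2) s y))

/-- `y` is the code of an atomic formula. -/
def atomF (k : ℕ) (y : Term) : Formula :=
  bigOr [
    .ex k (.ex (k + 1) (bigAnd [termF (k + 2) (.var k), termF (k + 2) (.var (k + 1)),
      .eq y (tEq (.var k) (.var (k + 1)))])),
    .ex k (.and (termF (k + 1) (.var k)) (.eq y (tPair (numeral 16) (.var k)))),
    .ex k (.and (termF (k + 1) (.var k)) (.eq y (tPair (numeral 17) (.var k))))]

/-- `y` is the code of `∀v u` or `∃v u` with `u` in `s`, `v` a variable such that `cond v`. -/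
def builtQ (k : ℕ) (s y : Term) (cond : Term → Formula) : Formula :=
  .ex k (.ex (k + 1) (bigAnd [varF (k + 2) (.var k), memF s (.var (k + 1)), cond (.var k),
    .or (.eq y (tAll (.var k) (.var (k + 1)))) (.eq y (tEx (.var k) (.var (k + 1))))]))

/-- `x` is the code of a formula. -/
def forF (k : ℕ) (x : Term) : Formula :=
  closureF k x (fun s y => bigOr [atomF (k + 2) y, built1 (k + 2) 18 s y, built2 (k + 2) 19 s y,
    built2 (k + 2) 20 s y, builtQ (k + 2) s y (fun _ => .eq .zero .zero)])

/-- The variable `v` does not occur free in the term or formula `x`: putting `0` for `v` leaves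
`x` unchanged. -/
def notFreeF (v x : Term) : Formula := .eq (.sub x .zero v) x

/-- `x` is the code of a sentence. -/
def sentF (k : ℕ) (x : Term) : Formula :=
  .and (forF k x) (.all k ((varF (k + 1) (.var k)).imp (notFreeF (.var k) x)))

/-- The term `t` is free for the variable `v` in the formula `x`. -/
def freeForF (k : ℕ) (t v x : Term) : Formula :=
  closureF k x (fun s y => bigOr [notFreeF v y, atomF (k + 2) y, built1 (k + 2) 18 s y,
    built2 (k + 2) 19 s y, built2 (k + 2) 20 s y, builtQ (k + 2) s y (fun w => notFreeF w t)])

/-- `y` is the value of the closed term with code `x`: the pair `(x, y)` belongs to a finite set of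
pairs each of which arises from others by applying a function symbol. -/
def valF (k : ℕ) (x y : Term) : Formula :=
  closureF k (tPair x y) (fun s p =>
    bigOr ([.eq p (tPair .zero .zero)] ++
      allFn1.map (fun f => .ex (k + 2) (.ex (k + 3) (bigAnd [
        memF s (tPair (.var (k + 2)) (.var (k + 3))),
        .eq p (tPair (tPair (numeral f.tag) (.var (k + 2))) (.app1 f (.var (k + 3))))]))) ++
      allFn2.map (fun f => .ex (k + 2) (.ex (k + 3) (.ex (k + 4) (.ex (k + 5) (bigAnd [
        memF s (tPair (.var (k + 2)) (.var (k + 3))),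
        memF s (tPair (.var (k + 4)) (.var (k + 5))),
        .eq p (tPair (tPair (numeral f.tag) (tPair (.var (k + 2)) (.var (k + 4))))
          (.app2 f (.var (k + 3)) (.var (k + 5))))]))))) ++
      [.ex (k + 2) (.ex (k + 3) (.ex (k + 4) (.ex (k + 5) (.ex (k + 6) (.ex (k + 7) (bigAnd [
        memF s (tPair (.var (k + 2)) (.var (k + 3))),
        memF s (tPair (.var (k + 4)) (.var (k + 5))),
        memF s (tPair (.var (k + 6)) (.var (k + 7))),
        .eq p (tPair
          (tPair (numeral 14) (tPair (.var (k + 2)) (tPair (.var (k + 4)) (.var (k + 6)))))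
          (.sub (.var (k + 3)) (.var (k + 5)) (.var (k + 7))))]))))))]))

/-- `x° = y°`: the closed terms `x` and `y` have the same value. -/
def sameValF (k : ℕ) (x y : Term) : Formula :=
  .ex k (.and (valF (k + 1) x (.var k)) (valF (k + 1) y (.var k)))

/-! ## The axioms of arithmetic -/

/-- The successor axioms, the recursion equations of `+` and `·`, and the defining axioms of the
further function symbols. Free variables are read as universally quantified. -/
def paAxioms : List Formula :=
  let x := Term.var 0
  let y := Term.var 1
  let z := Term.var 2
  let t := Term.var 3
  let v := Term.var 4
  let S := tSucc
  let add : Term → Term → Term := fun a b => .app2 .add a b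
  let mul : Term → Term → Term := fun a b => .app2 .mul a b
  let bit : Term → Term → Term := fun a b => .app2 .bit a b
  let sb : Term → Term := fun a => .sub a t v
  let nd : ℕ → Term → Term := fun k a => tPair (numeral k) a
  [ .neg (.eq (S x) .zero),
    (Formula.eq (S x) (S y)).imp (.eq x y),
    .eq (add x .zero) x,
    .eq (add x (S y)) (S (add x y)),
    .eq (mul x .zero) .zero,
    .eq (mul x (S y)) (add (mul x y) x),
    -- pairing: `y² + x` if `x < y`, and `x² + x + y` if `y ≤ x`
    (Formula.eq (add x (S z)) y).imp (.eq (tPair x y) (add (mul y y) x)),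
    (Formula.eq (add y z) x).imp (.eq (tPair x y) (add (add (mul x x) x) y)),
    -- binary digits
    .eq (bit (add x x) .zero) .zero,
    .eq (bit (S (add x x)) .zero) tOne,
    .eq (bit (add x x) (S y)) (bit x y),
    .eq (bit (S (add x x)) (S y)) (bit x y),
    -- numerals
    .eq (.app1 .num .zero) .zero,
    .eq (.app1 .num (S x)) (nd Fn1.succ.tag (.app1 .num x)),
    -- syntactic operations
    .eq (tNeg x) (nd 18 x),
    .eq (tEq x y) (nd 15 (tPair x y)),
    .eq (tAnd x y) (nd 19 (tPair x y)),
    .eq (tOr x y) (nd 20 (tPair x y)),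
    .eq (tAll x y) (nd 21 (tPair x y)),
    .eq (tEx x y) (nd 22 (tPair x y)),
    -- substitution
    .eq (sb v) t,
    (Formula.neg (.eq (nd 14 (tPair x (tPair y z))) v)).imp
      (.eq (sb (nd 14 (tPair x (tPair y z)))) (nd 14 (tPair (sb x) (tPair (sb y) (sb z))))),
    (Formula.neg (.eq x v)).imp
      ((bigAnd ((tags1 ++ tags2 ++ [14] ++ tagsQ).map
          (fun k => .all 1 (.neg (.eq x (nd k y)))))).imp
        (.eq (sb x) x)) ] ++
  tags1.map (fun k => (Formula.neg (.eq (nd k x) v)).imp (.eq (sb (nd k x)) (nd k (sb x)))) ++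
  tags2.map (fun k => (Formula.neg (.eq (nd k (tPair x y)) v)).imp
    (.eq (sb (nd k (tPair x y))) (nd k (tPair (sb x) (sb y))))) ++
  tagsQ.map (fun k => (Formula.neg (.eq (nd k (tPair x y)) v)).imp
    (.and ((Formula.eq x v).imp (.eq (sb (nd k (tPair x y))) (nd k (tPair x y))))
      ((Formula.neg (.eq x v)).imp (.eq (sb (nd k (tPair x y))) (nd k (tPair x (sb y)))))))

/-- `y` is the code of a logical axiom, of one of `paAxioms`, or of an instance of induction for
an arbitrary formula. The bound variables stand for formulas `a, b, c`, a variable `v` and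
terms `s, t`. -/
def axInstF (k : ℕ) (y : Term) : Formula :=
  let a := Term.var k
  let b := Term.var (k + 1)
  let c := Term.var (k + 2)
  let v := Term.var (k + 3)
  let s := Term.var (k + 4)
  let t := Term.var (k + 5)
  let m := k + 6
  .ex k (.ex (k + 1) (.ex (k + 2) (.ex (k + 3) (.ex (k + 4) (.ex (k + 5)
    (bigAnd [forF m a, forF m b, forF m c, varF m v, termF m s, termF m t,
      bigOr
        ((propAxioms tNeg tAnd tOr a b c).map (fun p => .eq y p) ++
        [ .and (freeForF m t v a) (.eq y (tImp (tAll v a) (.sub a t v))),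
          .and (freeForF m t v a) (.eq y (tImp (.sub a t v) (tEx v a))),
          .eq y (tImp (tAll v (tImp a b)) (tImp (tAll v a) (tAll v b))),
          .and (notFreeF v a) (.eq y (tImp a (tAll v a))),
          .and (notFreeF v b) (.eq y (tImp (tAll v (tImp a b)) (tImp (tEx v a) b))),
          .eq y (tEq t t),
          bigAnd [freeForF m s v a, freeForF m t v a,
            .eq y (tImp (tEq s t) (tImp (.sub a s v) (.sub a t v)))],
          .eq y (tImp
            (tAnd (.sub a .zero v)
              (tAll v (tImp a (.sub a (tPair (numeral Fn1.succ.tag) v) v))))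
            (tAll v a)) ] ++
        paAxioms.map (fun φ => .eq y (quote φ)))]))))))

/-- `Ax_PAT(x)`: `x` is a sentence that arises by universal generalization from a logical axiom or
an axiom of arithmetic, with induction for the whole language. -/
def axPATF (k : ℕ) (x : Term) : Formula :=
  .and (sentF k x)
    (closureF k x (fun s y => .or (axInstF (k + 2) y)
      (.ex (k + 2) (.ex (k + 3) (bigAnd [varF (k + 4) (.var (k + 2)), memF s (.var (k + 3)),
        .eq y (tAll (.var (k + 2)) (.var (k + 3)))])))))

/-! ## The theory `VFM*` -/

/-- Induction for the schematic predicate: `P(0) ∧ ∀x (P(x) → P(Sx)) → ∀x P(x)`. -/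
def indP : Formula :=
  (Formula.and (.P .zero) (.all 0 ((Formula.P (.var 0)).imp (.P (tSucc (.var 0)))))).imp
    (.all 0 (.P (.var 0)))

/-- `CT(x) ∧ CT(y) → ((Tr(x =. y) ↔ x° = y°) ∧ (Tr(x ≠. y) ↔ x° ≠ y°))` -/
def VF1 : Formula :=
  .all 0 (.all 1 ((Formula.and (ctF 2 (.var 0)) (ctF 2 (.var 1))).imp
    (.and ((Formula.tr (tEq (.var 0) (.var 1))).iff (sameValF 2 (.var 0) (.var 1)))
      ((Formula.tr (tNeg (tEq (.var 0) (.var 1)))).iff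
        (.neg (sameValF 2 (.var 0) (.var 1)))))))

/-- `Ax_PAT(x) → Tr(x)` -/
def VF2 : Formula := .all 0 ((axPATF 1 (.var 0)).imp (.tr (.var 0)))

/-- `∀z Tr(x(ż/v)) → Tr(∀.v x)`, for variables `v` -/
def VF3 : Formula :=
  .all 0 (.all 1 ((varF 2 (.var 1)).imp
    ((Formula.all 2 (.tr (.sub (.var 0) (.app1 .num (.var 2)) (.var 1)))).imp
      (.tr (tAll (.var 1) (.var 0))))))

/-- `Tr(x) ↔ Tr⌜Tr(ẋ)⌝` -/
def VF4 : Formula :=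
  .all 0 ((Formula.tr (.var 0)).iff (.tr (quoteDot (.tr (.var 0)) (.var 0))))

/-- `Sent(x) → (Tr(¬.⌜Tr(ẋ)⌝) ↔ Tr(¬.x))` -/
def VF5 : Formula :=
  .all 0 ((sentF 1 (.var 0)).imp
    ((Formula.tr (tNeg (quoteDot (.tr (.var 0)) (.var 0)))).iff (.tr (tNeg (.var 0)))))

/-- `Tr(x →. y) → (Tr(x) → Tr(y))` -/
def VF6 : Formula :=
  .all 0 (.all 1 ((Formula.tr (tImp (.var 0) (.var 1))).imp
    ((Formula.tr (.var 0)).imp (.tr (.var 1)))))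

/-- `Sent(x) → Tr⌜¬Tr(ẋ) ↔ Tr(¬.ẋ)⌝` -/
def VF7 : Formula :=
  .all 0 ((sentF 1 (.var 0)).imp
    (.tr (quoteDot ((Formula.neg (.tr (.var 0))).iff (.tr (tNeg (.var 0)))) (.var 0))))

/-- `Tr⌜Tr(ẋ) → Sent(ẋ)⌝` -/
def VF8 : Formula :=
  .all 0 (.tr (quoteDot ((Formula.tr (.var 0)).imp (sentF 1 (.var 0))) (.var 0)))

/-- `∀x (Tr⌜P(ẋ)⌝ ↔ P(x))` -/
def PDisq : Formula :=
  .all 0 ((Formula.tr (quoteDot (.P (.var 0)) (.var 0))).iff (.P (.var 0)))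

/-- The nonlogical axioms of `VFM*`. The scheme of induction is replaced by induction for `P`. -/
def axiomsVFMStar : Set Formula :=
  {φ | φ ∈ paAxioms} ∪ {indP} ∪ {VF1, VF2, VF3, VF4, VF5, VF6, VF7, VF8} ∪ {PDisq}

/-- `VFM* ⊢ φ`. -/
inductive VFMStar : Formula → Prop
  | logic {φ} (h : LogAx φ) : VFMStar φ
  | nonlogical {φ} (h : φ ∈ axiomsVFMStar) : VFMStar φ
  | mp {φ ψ} (h1 : VFMStar (φ.imp ψ)) (h2 : VFMStar φ) : VFMStar ψ
  | gen {φ} (v : ℕ) (h : VFMStar φ) : VFMStar (Formula.all v φ)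
  | pSubst {A : Formula} (B : Formula) (i : ℕ) (hA : A.TrFree) (hcap : A.FreeForP B i)
      (h : VFMStar A) : VFMStar (A.substP B i)

end VFM

namespace VFM

/-! ## Codes -/

/-! The jump is monotone, because a larger `Y` has fewer maximally consistent extensions. Hence the
stages increase, and they stabilise since the ordinals do not inject into `Set ℕ`. Each stage is
consistent: Lindenbaum's lemma gives a maximally consistent `Z` above a consistent `Y`, every
sentence in `jump X Y` is true in `(ℕ, X, Z)`, and a set of sentences with a model is consistent;
limits are unions of chains.

Let `Y` be a consistent fixed point over `X`, so that a sentence belongs to `Y` iff it is true in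
`(ℕ, X, Z)` for all maximally consistent `Z ⊇ Y`. Truth in these structures is preserved by
derivations, so `Y` is deductively closed and therefore equals the intersection of its maximally
consistent extensions (`IsFixedPoint.mem_iff_forall_maxCons`). This links "`Tr(n)` is true for every
`Z`" with `n ∈ Y` and yields VF4 and VF5. VF7 and VF8 express that each `Z` is maximally consistent
and consists of sentences. VF3 holds because all structures have domain `ℕ`, VF6 because truth is
closed under modus ponens, VF2 because the axioms of PAT are true in every `(ℕ, X, Z)`, and VF1 and
P-Disq because the sentences concerned do not mention `Tr`.

The rule P-Subst is the reason for treating all `X` at once (`VFMStar.models`). If `X'` is the set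
defined by `B` in `(ℕ, X, Y)`, then `A(B/P)` says in `(ℕ, X, Y)` what `A` says with `P` read as
`X'`. As `A` has no `Tr`, the truth predicate may be read as any fixed point over `X'`, and there
the induction hypothesis applies.

Much of the work is decoding: the arithmetical formulas must define the intended notions in the
standard model. Formulas that occur only as hypotheses of axioms (`ctF`, `freeForF`, `axPATF`) need
just one direction; `sentF` and `valF` need both. -/

theorem pair_eq_zero_iff {a b : ℕ} : Nat.pair a b = 0 ↔ a = 0 ∧ b = 0 := by
  rw [← Nat.pair_eq_pair]; rfl

theorem zero_eq_pair_iff {a b : ℕ} : 0 = Nat.pair a b ↔ a = 0 ∧ b = 0 := by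
  rw [eq_comm, pair_eq_zero_iff]

theorem Fn1.tag_injective : Function.Injective Fn1.tag := by
  intro f g h; cases f <;> cases g <;> simp_all [Fn1.tag]

theorem Fn2.tag_injective : Function.Injective Fn2.tag := by
  intro f g h; cases f <;> cases g <;> simp_all [Fn2.tag]

theorem Fn1.tag_mem (f : Fn1) : f.tag ∈ tags1 := by cases f <;> decide

theorem Fn2.tag_mem (f : Fn2) : f.tag ∈ tags2 := by cases f <;> decide

theorem codeVar_injective : Function.Injective codeVar := fun i j h => by
  simpa [codeVar] using h

theorem Term.code_injective : Function.Injective Term.code := by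
  intro s
  induction s with
  | var i =>
    intro t h
    cases t with
    | app1 g _ => cases g <;> simp_all [Term.code, codeVar, Fn1.tag]
    | app2 g _ _ => cases g <;> simp_all [Term.code, codeVar, Fn2.tag]
    | _ => simp_all [Term.code, codeVar, pair_eq_zero_iff]
  | zero =>
    intro t h
    cases t with
    | app1 g _ => cases g <;> simp_all [Term.code, Fn1.tag, zero_eq_pair_iff]
    | app2 g _ _ => cases g <;> simp_all [Term.code, Fn2.tag, zero_eq_pair_iff]
    | _ => simp_all [Term.code, codeVar, zero_eq_pair_iff]
  | app1 f s ih =>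
    intro t h
    cases t with
    | app1 g t =>
      simp only [Term.code, Nat.pair_eq_pair] at h
      rw [Fn1.tag_injective h.1, ih h.2]
    | app2 g _ _ => cases f <;> cases g <;> simp_all [Term.code, Fn1.tag, Fn2.tag]
    | _ => cases f <;> simp_all [Term.code, codeVar, Fn1.tag, pair_eq_zero_iff]
  | app2 f s s' ih ih' =>
    intro t h
    cases t with
    | app2 g t t' =>
      simp only [Term.code, Nat.pair_eq_pair] at h
      rw [Fn2.tag_injective h.1, ih h.2.1, ih' h.2.2]
    | app1 g _ => cases f <;> cases g <;> simp_all [Term.code, Fn1.tag, Fn2.tag]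
    | _ => cases f <;> simp_all [Term.code, codeVar, Fn2.tag, pair_eq_zero_iff]
  | sub x t v ihx iht ihv =>
    intro u h
    cases u with
    | sub x' t' v' =>
      simp only [Term.code, Nat.pair_eq_pair] at h
      rw [ihx h.2.1, iht h.2.2.1, ihv h.2.2.2]
    | app1 g _ => cases g <;> simp_all [Term.code, Fn1.tag]
    | app2 g _ _ => cases g <;> simp_all [Term.code, Fn2.tag]
    | _ => simp_all [Term.code, codeVar, pair_eq_zero_iff]

theorem Formula.code_injective : Function.Injective Formula.code := by
  intro φ
  induction φ <;> intro ψ h <;> cases ψ <;>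
    simp_all [Formula.code, Term.code_injective.eq_iff, codeVar_injective.eq_iff] <;> grind

/-- Terms use the tags up to 14 (with `0 = Nat.pair 0 0`), formulas those from 15 on. -/
theorem Term.code_ne_formula_code (t : Term) (φ : Formula) : t.code ≠ φ.code := by
  rcases t with _ | _ | ⟨f, _⟩ | ⟨f, _, _⟩ | _ <;> cases φ <;> try cases f
  all_goals simp [Term.code, Formula.code, codeVar, zero_eq_pair_iff, Fn1.tag, Fn2.tag]

/-! ## Substitution on codes -/

section substCode
variable (t v : ℕ)

theorem substCode_self : substCode t v v = t := by rw [substCode]; simp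

variable {t v} {k x y z : ℕ}

theorem substCode_tags1 (hk : k ∈ tags1) (hv : Nat.pair k x ≠ v) :
    substCode t v (Nat.pair k x) = Nat.pair k (substCode t v x) := by
  rw [substCode]; simp [hk, hv]

theorem substCode_tags2 (hk : k ∈ tags2) (hv : Nat.pair k (Nat.pair x y) ≠ v) :
    substCode t v (Nat.pair k (Nat.pair x y)) =
      Nat.pair k (Nat.pair (substCode t v x) (substCode t v y)) := by
  have h1 : k ∉ tags1 := (by decide : ∀ k ∈ tags2, k ∉ tags1) k hk
  rw [substCode]; simp [hk, hv, h1]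

theorem substCode_14 (hv : Nat.pair 14 (Nat.pair x (Nat.pair y z)) ≠ v) :
    substCode t v (Nat.pair 14 (Nat.pair x (Nat.pair y z))) =
      Nat.pair 14 (Nat.pair (substCode t v x) (Nat.pair (substCode t v y) (substCode t v z))) := by
  rw [substCode]; simp [hv, tags1, tags2]

theorem substCode_tagsQ (hk : k ∈ tagsQ) (hv : Nat.pair k (Nat.pair x y) ≠ v) :
    substCode t v (Nat.pair k (Nat.pair x y)) =
      if x = v then Nat.pair k (Nat.pair x y) else Nat.pair k (Nat.pair x (substCode t v y)) := by
  have h1 : k ∉ tags1 := (by decide : ∀ k ∈ tagsQ, k ∉ tags1) k hk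
  have h2 : k ∉ tags2 := (by decide : ∀ k ∈ tagsQ, k ∉ tags2) k hk
  have h3 : k ≠ 14 := (by decide : ∀ k ∈ tagsQ, k ≠ 14) k hk
  rw [substCode]; simp [hk, hv, h1, h2, h3]

theorem substCode_other (hv : x ≠ v) (h : ∀ k ∈ tags1 ++ tags2 ++ [14] ++ tagsQ, x.unpair.1 ≠ k) :
    substCode t v x = x := by
  have h1 : x.unpair.1 ∉ tags1 := fun h' => h _ (by simp [h']) rfl
  have h2 : x.unpair.1 ∉ tags2 := fun h' => h _ (by simp [h']) rfl
  have h3 : x.unpair.1 ≠ 14 := fun h' => h _ (by simp [h']) rfl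
  have h4 : x.unpair.1 ∉ tagsQ := fun h' => h _ (by simp [h']) rfl
  rw [substCode]; simp [hv, h1, h2, h3, h4]

end substCode

/-- Tag 1 is reserved for variables, so the test `x = v` in `substCode` succeeds only at an
occurrence of the variable itself, never at a compound code. -/
theorem Term.substCode_code (s u : Term) (i : ℕ) :
    substCode u.code (codeVar i) s.code = (s.subst u i).code := by
  induction s with
  | var j =>
    by_cases h : j = i
    · simp [Term.subst, h, Term.code, substCode_self]
    · rw [Term.code, substCode_other (by simpa [codeVar_injective.eq_iff])]
      · simp [Term.subst, h, Term.code]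
      · simp [codeVar, tags1, tags2, tagsQ]
  | zero =>
    rw [Term.code, substCode_other]
    · rfl
    · simp [codeVar, zero_eq_pair_iff]
    · simp [tags1, tags2, tagsQ]
  | app1 f s ih =>
    rw [Term.code, substCode_tags1 f.tag_mem (by cases f <;> simp [codeVar, Fn1.tag]), ih]; rfl
  | app2 f s s' ih ih' =>
    rw [Term.code, substCode_tags2 f.tag_mem (by cases f <;> simp [codeVar, Fn2.tag]), ih, ih']; rfl
  | sub x t v ihx iht ihv =>
    rw [Term.code, substCode_14 (by simp [codeVar]), ihx, iht, ihv]; rfl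

theorem Formula.substCode_code (φ : Formula) (u : Term) (i : ℕ) :
    substCode u.code (codeVar i) φ.code = (φ.subst u i).code := by
  induction φ with
  | eq s t =>
    rw [Formula.code, substCode_tags2 (by decide) (by simp [codeVar]), s.substCode_code,
      t.substCode_code]; rfl
  | tr t => rw [Formula.code, substCode_tags1 (by decide) (by simp [codeVar]), t.substCode_code]; rfl
  | P t => rw [Formula.code, substCode_tags1 (by decide) (by simp [codeVar]), t.substCode_code]; rfl
  | neg φ ih => rw [Formula.code, substCode_tags1 (by decide) (by simp [codeVar]), ih]; rfl
  | and φ ψ ih ih' =>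
    rw [Formula.code, substCode_tags2 (by decide) (by simp [codeVar]), ih, ih']; rfl
  | or φ ψ ih ih' =>
    rw [Formula.code, substCode_tags2 (by decide) (by simp [codeVar]), ih, ih']; rfl
  | all v φ ih =>
    rw [Formula.code, substCode_tagsQ (by decide) (by simp [codeVar]), ih, Formula.subst]
    simp only [codeVar_injective.eq_iff]
    split_ifs <;> rfl
  | ex v φ ih =>
    rw [Formula.code, substCode_tagsQ (by decide) (by simp [codeVar]), ih, Formula.subst]
    simp only [codeVar_injective.eq_iff]
    split_ifs <;> rfl

/-- The shape of a number that is mapped by substitution to a number of a given shape. -/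
theorem substCode_eq_pair {t v x k y : ℕ} (h : substCode t v x = Nat.pair k y) :
    x = v ∨ x = Nat.pair k y ∨
    (k ∈ tags1 ∧ ∃ a, x = Nat.pair k a ∧ y = substCode t v a) ∨
    (k ∈ tags2 ∧ ∃ a b, x = Nat.pair k (Nat.pair a b) ∧
      y = Nat.pair (substCode t v a) (substCode t v b)) ∨
    (k = 14 ∧ ∃ a b c, x = Nat.pair k (Nat.pair a (Nat.pair b c)) ∧
      y = Nat.pair (substCode t v a) (Nat.pair (substCode t v b) (substCode t v c))) ∨
    (k ∈ tagsQ ∧ ∃ a b, x = Nat.pair k (Nat.pair a b) ∧ y = Nat.pair a (substCode t v b)) := by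
  rw [substCode] at h
  split_ifs at h with h0 h1 h2 h3 h4 h5
  · exact .inl h0
  · obtain ⟨rfl, rfl⟩ := Nat.pair_eq_pair.1 h
    exact .inr <| .inr <| .inl ⟨h1, _, (Nat.pair_unpair x).symm, rfl⟩
  · obtain ⟨rfl, rfl⟩ := Nat.pair_eq_pair.1 h
    exact .inr <| .inr <| .inr <| .inl ⟨h2, _, _, by simp, rfl⟩
  · obtain ⟨rfl, rfl⟩ := Nat.pair_eq_pair.1 h
    exact .inr <| .inr <| .inr <| .inr <| .inl ⟨rfl, _, _, _, by simp [← h3], rfl⟩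
  · exact .inr <| .inl h
  · obtain ⟨rfl, rfl⟩ := Nat.pair_eq_pair.1 h
    exact .inr <| .inr <| .inr <| .inr <| .inr ⟨h4, _, _, by simp, rfl⟩
  · exact .inr <| .inl h

theorem Term.exists_code_of_substCode {t i : ℕ} (u : Term) :
    ∀ x : ℕ, substCode t (codeVar i) x = u.code → ∃ r : Term, r.code = x := by
  induction u with
  | var j =>
    intro x h
    replace h := substCode_eq_pair h
    rcases h with h | h | ⟨h, _⟩ | ⟨h, _⟩ | ⟨h, _⟩ | ⟨h, _⟩
    · exact ⟨.var i, h.symm⟩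
    · exact ⟨.var j, h.symm⟩
    all_goals simp [tags1, tags2, tagsQ] at h
  | zero =>
    intro x h
    -- The code of `0` is `Nat.pair 0 0`, so it also has the shape of a pair, with a tag on which no
    -- recursion takes place.
    replace h := substCode_eq_pair (k := 0) (y := 0) h
    rcases h with h | h | ⟨h, _⟩ | ⟨h, _⟩ | ⟨h, _⟩ | ⟨h, _⟩
    · exact ⟨.var i, h.symm⟩
    · exact ⟨.zero, h.symm⟩
    all_goals simp [tags1, tags2, tagsQ] at h
  | app1 f u ih =>
    intro x h
    replace h := substCode_eq_pair h
    rcases h with h | h | ⟨_, a, rfl, h⟩ | ⟨h, _⟩ | ⟨h, _⟩ | ⟨h, _⟩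
    · exact ⟨.var i, h.symm⟩
    · exact ⟨.app1 f u, h.symm⟩
    · obtain ⟨r, rfl⟩ := ih a h.symm
      exact ⟨.app1 f r, rfl⟩
    all_goals cases f <;> simp [Fn1.tag, tags2, tagsQ] at h
  | app2 f u u' ih ih' =>
    intro x h
    replace h := substCode_eq_pair h
    rcases h with h | h | ⟨h, _⟩ | ⟨_, a, b, rfl, h⟩ | ⟨h, _⟩ | ⟨h, _⟩
    · exact ⟨.var i, h.symm⟩
    · exact ⟨.app2 f u u', h.symm⟩
    · cases f <;> simp [Fn2.tag, tags1] at h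
    · rw [Nat.pair_eq_pair] at h
      obtain ⟨r, rfl⟩ := ih a h.1.symm
      obtain ⟨r', rfl⟩ := ih' b h.2.symm
      exact ⟨.app2 f r r', rfl⟩
    all_goals cases f <;> simp [Fn2.tag, tagsQ] at h
  | sub u u' u'' ih ih' ih'' =>
    intro x h
    replace h := substCode_eq_pair h
    rcases h with h | h | ⟨h, _⟩ | ⟨h, _⟩ | ⟨_, a, b, c, rfl, h⟩ | ⟨h, _⟩
    · exact ⟨.var i, h.symm⟩
    · exact ⟨.sub u u' u'', h.symm⟩
    · simp [tags1] at h
    · simp [tags2] at h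
    · simp only [Nat.pair_eq_pair] at h
      obtain ⟨r, rfl⟩ := ih a h.1.symm
      obtain ⟨r', rfl⟩ := ih' b h.2.1.symm
      obtain ⟨r'', rfl⟩ := ih'' c h.2.2.symm
      exact ⟨.sub r r' r'', rfl⟩
    · simp [tagsQ] at h

/-- Needed for VF3, where `x` ranges over all numbers: once a substitution instance of `x` is a
formula, `x` itself must be one. Substitution preserves the outermost tag except at the variable, so
the shape of the result determines that of `x`. -/
theorem Formula.exists_code_of_substCode {t : Term} {i : ℕ} (φ : Formula) :
    ∀ x : ℕ, substCode t.code (codeVar i) x = φ.code → ∃ ψ : Formula, ψ.code = x := by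
  -- Otherwise the result would be the code of the term `t`.
  have key : ∀ (x : ℕ) (φ : Formula), substCode t.code (codeVar i) x = φ.code → x ≠ codeVar i := by
    rintro x φ h rfl
    rw [substCode_self] at h
    exact Term.code_ne_formula_code _ _ h
  induction φ with
  | eq u u' =>
    intro x h
    have hx := key x _ h
    replace h := substCode_eq_pair h
    rcases h with h | h | ⟨h, _⟩ | ⟨_, a, b, rfl, h⟩ | ⟨h, _⟩ | ⟨h, _⟩
    · exact absurd h hx
    · exact ⟨.eq u u', h.symm⟩
    · simp [tags1] at h
    · rw [Nat.pair_eq_pair] at h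
      obtain ⟨r, rfl⟩ := u.exists_code_of_substCode a h.1.symm
      obtain ⟨r', rfl⟩ := u'.exists_code_of_substCode b h.2.symm
      exact ⟨.eq r r', rfl⟩
    all_goals simp [tagsQ] at h
  | tr u =>
    intro x h
    have hx := key x _ h
    replace h := substCode_eq_pair h
    rcases h with h | h | ⟨_, a, rfl, h⟩ | ⟨h, _⟩ | ⟨h, _⟩ | ⟨h, _⟩
    · exact absurd h hx
    · exact ⟨.tr u, h.symm⟩
    · obtain ⟨r, rfl⟩ := u.exists_code_of_substCode a h.symm
      exact ⟨.tr r, rfl⟩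
    all_goals simp [tags2, tagsQ] at h
  | P u =>
    intro x h
    have hx := key x _ h
    replace h := substCode_eq_pair h
    rcases h with h | h | ⟨_, a, rfl, h⟩ | ⟨h, _⟩ | ⟨h, _⟩ | ⟨h, _⟩
    · exact absurd h hx
    · exact ⟨.P u, h.symm⟩
    · obtain ⟨r, rfl⟩ := u.exists_code_of_substCode a h.symm
      exact ⟨.P r, rfl⟩
    all_goals simp [tags2, tagsQ] at h
  | neg φ ih =>
    intro x h
    have hx := key x _ h
    replace h := substCode_eq_pair h
    rcases h with h | h | ⟨_, a, rfl, h⟩ | ⟨h, _⟩ | ⟨h, _⟩ | ⟨h, _⟩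
    · exact absurd h hx
    · exact ⟨.neg φ, h.symm⟩
    · obtain ⟨r, rfl⟩ := ih a h.symm
      exact ⟨.neg r, rfl⟩
    all_goals simp [tags2, tagsQ] at h
  | and φ ψ ih ih' =>
    intro x h
    have hx := key x _ h
    replace h := substCode_eq_pair h
    rcases h with h | h | ⟨h, _⟩ | ⟨_, a, b, rfl, h⟩ | ⟨h, _⟩ | ⟨h, _⟩
    · exact absurd h hx
    · exact ⟨.and φ ψ, h.symm⟩
    · simp [tags1] at h
    · rw [Nat.pair_eq_pair] at h
      obtain ⟨r, rfl⟩ := ih a h.1.symm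
      obtain ⟨r', rfl⟩ := ih' b h.2.symm
      exact ⟨.and r r', rfl⟩
    all_goals simp [tagsQ] at h
  | or φ ψ ih ih' =>
    intro x h
    have hx := key x _ h
    replace h := substCode_eq_pair h
    rcases h with h | h | ⟨h, _⟩ | ⟨_, a, b, rfl, h⟩ | ⟨h, _⟩ | ⟨h, _⟩
    · exact absurd h hx
    · exact ⟨.or φ ψ, h.symm⟩
    · simp [tags1] at h
    · rw [Nat.pair_eq_pair] at h
      obtain ⟨r, rfl⟩ := ih a h.1.symm
      obtain ⟨r', rfl⟩ := ih' b h.2.symm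
      exact ⟨.or r r', rfl⟩
    all_goals simp [tagsQ] at h
  | all v φ ih =>
    intro x h
    have hx := key x _ h
    replace h := substCode_eq_pair h
    rcases h with h | h | ⟨h, _⟩ | ⟨h, _⟩ | ⟨h, _⟩ | ⟨_, a, b, rfl, h⟩
    · exact absurd h hx
    · exact ⟨.all v φ, h.symm⟩
    · simp [tags1] at h
    · simp [tags2] at h
    · simp at h
    · rw [Nat.pair_eq_pair] at h
      obtain ⟨rfl, h⟩ := h
      obtain ⟨r, rfl⟩ := ih b h.symm
      exact ⟨.all v r, rfl⟩
  | ex v φ ih =>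
    intro x h
    have hx := key x _ h
    replace h := substCode_eq_pair h
    rcases h with h | h | ⟨h, _⟩ | ⟨h, _⟩ | ⟨h, _⟩ | ⟨_, a, b, rfl, h⟩
    · exact absurd h hx
    · exact ⟨.ex v φ, h.symm⟩
    · simp [tags1] at h
    · simp [tags2] at h
    · simp at h
    · rw [Nat.pair_eq_pair] at h
      obtain ⟨rfl, h⟩ := h
      obtain ⟨r, rfl⟩ := ih b h.symm
      exact ⟨.ex v r, rfl⟩

/-! ## Free variables and substitution -/

@[simp] theorem numeral_vars (n : ℕ) : (numeral n).vars = ∅ := by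
  induction n with
  | zero => rfl
  | succ n ih => simpa [numeral, Term.vars] using ih

@[simp] theorem numeral_val (e : ℕ → ℕ) (n : ℕ) : (numeral n).val e = n := by
  induction n with
  | zero => rfl
  | succ n ih => simp [numeral, Term.val, Fn1.interp, ih]

theorem Term.val_congr {e e' : ℕ → ℕ} (t : Term) (h : ∀ j ∈ t.vars, e j = e' j) :
    t.val e = t.val e' := by
  induction t <;> simp_all [Term.val, Term.vars]

theorem Term.val_update {e : ℕ → ℕ} {t : Term} {i n : ℕ} (h : i ∉ t.vars) :
    t.val (Function.update e i n) = t.val e :=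
  t.val_congr fun j hj => Function.update_of_ne (by rintro rfl; exact h hj) _ _

theorem Formula.sat_congr {X Y : Set ℕ} (φ : Formula) :
    ∀ {e e' : ℕ → ℕ}, (∀ j ∈ φ.fv, e j = e' j) → (φ.Sat X Y e ↔ φ.Sat X Y e') := by
  induction φ with
  | eq s t =>
    intro e e' h
    simp only [Formula.Sat]
    rw [s.val_congr fun j hj => h j (by simp [Formula.fv, hj]),
      t.val_congr fun j hj => h j (by simp [Formula.fv, hj])]
  | tr t => intro e e' h; simp only [Formula.Sat]; rw [t.val_congr h]
  | P t => intro e e' h; simp only [Formula.Sat]; rw [t.val_congr h]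
  | neg φ ih => intro e e' h; exact not_congr (ih h)
  | and φ ψ ih ih' =>
    intro e e' h
    exact and_congr (ih fun j hj => h j (by simp [Formula.fv, hj]))
      (ih' fun j hj => h j (by simp [Formula.fv, hj]))
  | or φ ψ ih ih' =>
    intro e e' h
    exact or_congr (ih fun j hj => h j (by simp [Formula.fv, hj]))
      (ih' fun j hj => h j (by simp [Formula.fv, hj]))
  | all v φ ih =>
    intro e e' h
    refine forall_congr' fun n => ih fun j hj => ?_
    by_cases hjv : j = v
    · simp [hjv]
    · simpa [hjv] using h j (by simp [Formula.fv, hj, hjv])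
  | ex v φ ih =>
    intro e e' h
    refine exists_congr fun n => ih fun j hj => ?_
    by_cases hjv : j = v
    · simp [hjv]
    · simpa [hjv] using h j (by simp [Formula.fv, hj, hjv])

theorem Formula.sat_update {X Y : Set ℕ} {φ : Formula} {e : ℕ → ℕ} {i n : ℕ} (h : i ∉ φ.fv) :
    φ.Sat X Y (Function.update e i n) ↔ φ.Sat X Y e :=
  φ.sat_congr fun j hj => Function.update_of_ne (by rintro rfl; exact h hj) _ _

theorem Formula.IsSentence.sat_iff_models {X Y : Set ℕ} {φ : Formula} (h : φ.IsSentence)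
    (e : ℕ → ℕ) : φ.Sat X Y e ↔ Models X Y φ :=
  ⟨fun he _ => (φ.sat_congr fun j hj => by rw [h] at hj; simp at hj).1 he, fun hm => hm e⟩

theorem Term.val_subst (e : ℕ → ℕ) (s u : Term) (i : ℕ) :
    (s.subst u i).val e = s.val (Function.update e i (u.val e)) := by
  induction s with
  | var j => by_cases h : j = i <;> simp [Term.subst, Term.val, h]
  | _ => simp_all [Term.subst, Term.val]

theorem Term.subst_of_notMem {s u : Term} {i : ℕ} (h : i ∉ s.vars) : s.subst u i = s := by
  induction s <;> simp_all [Term.subst, Term.vars, Ne.symm]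

theorem Formula.subst_of_notMem {φ : Formula} {u : Term} {i : ℕ} (h : i ∉ φ.fv) :
    φ.subst u i = φ := by
  induction φ with
  | all v φ ih =>
    by_cases hv : v = i
    · simp [Formula.subst, hv]
    · simp only [Formula.fv, Finset.mem_erase, not_and] at h
      simp [Formula.subst, hv, ih (h (Ne.symm hv))]
  | ex v φ ih =>
    by_cases hv : v = i
    · simp [Formula.subst, hv]
    · simp only [Formula.fv, Finset.mem_erase, not_and] at h
      simp [Formula.subst, hv, ih (h (Ne.symm hv))]
  | _ => simp_all [Formula.subst, Formula.fv, Term.subst_of_notMem]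

theorem Term.vars_subst_of_closed (s : Term) {u : Term} (hu : u.vars = ∅) (i : ℕ) :
    (s.subst u i).vars = s.vars.erase i := by
  induction s with
  | var j => by_cases h : j = i <;> simp [Term.subst, Term.vars, h, hu, Finset.erase_eq_of_notMem, Ne.symm]
  | zero => rfl
  | _ => simp_all [Term.subst, Term.vars, Finset.erase_union_distrib]

theorem Formula.fv_subst_of_closed (φ : Formula) {u : Term} (hu : u.vars = ∅) (i : ℕ) :
    (φ.subst u i).fv = φ.fv.erase i := by
  induction φ with
  | all v φ ih =>
    by_cases h : v = i
    · simp [Formula.subst, Formula.fv, h]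
    · simp [Formula.subst, Formula.fv, h, ih, Finset.erase_right_comm]
  | ex v φ ih =>
    by_cases h : v = i
    · simp [Formula.subst, Formula.fv, h]
    · simp [Formula.subst, Formula.fv, h, ih, Finset.erase_right_comm]
  | _ => simp_all [Formula.subst, Formula.fv, Finset.erase_union_distrib, Term.vars_subst_of_closed]

theorem Formula.freeFor_of_notMem {φ : Formula} {u : Term} {i : ℕ} (h : i ∉ φ.fv) :
    φ.FreeFor u i := by
  induction φ <;> simp_all [Formula.FreeFor, Formula.fv]

/-- A quantifier over `vᵢ` leaves nothing to substitute for, and any other quantifier cannot capture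
`vᵢ`. This covers numerals and the term `S vᵢ` of the induction axioms. -/
theorem Formula.freeFor_of_vars_subset {φ : Formula} {u : Term} {i : ℕ} (hu : u.vars ⊆ {i}) :
    φ.FreeFor u i := by
  induction φ with
  | all v φ ih =>
    by_cases h : v = i
    · exact .inl (by simp [h])
    · exact .inr ⟨fun hv => h (by simpa using hu hv), ih⟩
  | ex v φ ih =>
    by_cases h : v = i
    · exact .inl (by simp [h])
    · exact .inr ⟨fun hv => h (by simpa using hu hv), ih⟩
  | _ => simp_all [Formula.FreeFor]

theorem Formula.sat_subst {X Y : Set ℕ} (φ : Formula) {u : Term} {i : ℕ} :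
    ∀ (e : ℕ → ℕ), φ.FreeFor u i →
      ((φ.subst u i).Sat X Y e ↔ φ.Sat X Y (Function.update e i (u.val e))) := by
  induction φ with
  | all v φ ih =>
    intro e h
    rcases h with h | ⟨h1, h2⟩
    · rw [Formula.subst_of_notMem (φ := .all v φ) h, Formula.sat_update (φ := .all v φ) h]
    · by_cases hv : v = i
      · subst hv
        rw [Formula.sat_update (φ := .all v φ) (by simp [Formula.fv])]
        simp [Formula.subst]
      · simp only [Formula.subst, hv, if_false, Formula.Sat]
        refine forall_congr' fun n => ?_
        rw [ih _ h2, Term.val_update h1, Function.update_comm hv]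
  | ex v φ ih =>
    intro e h
    rcases h with h | ⟨h1, h2⟩
    · rw [Formula.subst_of_notMem (φ := .ex v φ) h, Formula.sat_update (φ := .ex v φ) h]
    · by_cases hv : v = i
      · subst hv
        rw [Formula.sat_update (φ := .ex v φ) (by simp [Formula.fv])]
        simp [Formula.subst]
      · simp only [Formula.subst, hv, if_false, Formula.Sat]
        refine exists_congr fun n => ?_
        rw [ih _ h2, Term.val_update h1, Function.update_comm hv]
  | _ => simp_all [Formula.subst, Formula.Sat, Formula.FreeFor, Term.val_subst]

/-- The semantic content of P-Subst. The set `Y'` is arbitrary because `A` does not contain `Tr`;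
this freedom allows a change to a fixed point over another interpretation of `P`. -/
theorem Formula.sat_substP {X Y Y' : Set ℕ} {B : Formula} {i : ℕ} (A : Formula) :
    ∀ (e : ℕ → ℕ), A.TrFree → A.FreeForP B i →
      ((A.substP B i).Sat X Y e ↔
        A.Sat {n | B.Sat X Y (Function.update e i n)} Y' e) := by
  -- The quantifiers of `A` do not bind parameters of `B`, so the set defined by `B` stays the same
  -- inside their scope.
  have key : ∀ {v : ℕ} (e : ℕ → ℕ) (n : ℕ), v ∉ B.fv.erase i →
      {m | B.Sat X Y (Function.update (Function.update e v n) i m)} =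
        {m | B.Sat X Y (Function.update e i m)} := by
    intro v e n hv
    ext m
    refine B.sat_congr fun j hj => ?_
    by_cases hji : j = i
    · simp [hji]
    · have : j ≠ v := by rintro rfl; exact hv (by simp [hji, hj])
      simp [hji, this]
  induction A with
  | eq => intro e _ _; rfl
  | tr => intro e h; exact h.elim
  | P t => intro e _ h; exact B.sat_subst e h
  | neg φ ih => intro e h h'; exact not_congr (ih e h h')
  | and φ ψ ih ih' => intro e h h'; exact and_congr (ih e h.1 h'.1) (ih' e h.2 h'.2)
  | or φ ψ ih ih' => intro e h h'; exact or_congr (ih e h.1 h'.1) (ih' e h.2 h'.2)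
  | all v φ ih =>
    intro e h h'
    refine forall_congr' fun n => ?_
    rw [ih _ h h'.2, key e n h'.1]
  | ex v φ ih =>
    intro e h h'
    refine exists_congr fun n => ?_
    rw [ih _ h h'.2, key e n h'.1]

/-- Substituting a closed term removes `i` from the variables. This is why `notFreeF` is a correct
test. -/
theorem Term.notMem_of_subst_zero {s : Term} {i : ℕ} (h : s.subst .zero i = s) : i ∉ s.vars := by
  intro hi
  have := s.vars_subst_of_closed (u := .zero) rfl i
  rw [h] at this
  rw [this] at hi
  simp at hi

theorem Formula.notMem_of_subst_zero {φ : Formula} {i : ℕ} (h : φ.subst .zero i = φ) :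
    i ∉ φ.fv := by
  intro hi
  have := φ.fv_subst_of_closed (u := .zero) rfl i
  rw [h] at this
  rw [this] at hi
  simp at hi

/-! ## Soundness of first-order logic -/

theorem LogAx.models {φ : Formula} (h : LogAx φ) (X Y : Set ℕ) : Models X Y φ := by
  intro e
  cases h with
  | prop A B C _ h =>
    simp only [propAxioms, List.mem_cons, List.not_mem_nil, or_false] at h
    rcases h with h | h | h | h | h | h | h | h | h | h <;> subst h <;>
      simp only [Formula.Sat] <;> tauto
  | allElim A v t h =>
    refine or_iff_not_imp_left.2 fun h1 => ?_
    exact (A.sat_subst e h).2 (not_not.1 h1 _)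
  | exIntro A v t h =>
    refine or_iff_not_imp_left.2 fun h1 => ?_
    exact ⟨_, (A.sat_subst e h).1 (not_not.1 h1)⟩
  | allImp A B v =>
    simp only [Formula.imp, Formula.Sat]
    by_contra! h
    obtain ⟨h1, h2, n, h3⟩ := h
    rcases h1 n with h | h
    · exact h (h2 n)
    · exact h3 h
  | allVac A v h =>
    refine or_iff_not_imp_left.2 fun h1 n => (Formula.sat_update h).2 (not_not.1 h1)
  | exElim A B v h =>
    simp only [Formula.imp, Formula.Sat]
    by_contra! h'
    obtain ⟨h1, ⟨n, h2⟩, h3⟩ := h'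
    rcases h1 n with h' | h'
    · exact h' h2
    · exact h3 ((Formula.sat_update h).1 h')
  | eqRefl t => rfl
  | eqSubst A v s t hs ht =>
    simp only [Formula.imp, Formula.Sat, A.sat_subst e hs, A.sat_subst e ht]
    by_cases h : s.val e = t.val e
    · rw [h]; tauto
    · exact .inl h

theorem Models.mp {X Y : Set ℕ} {φ ψ : Formula} (h : Models X Y (φ.imp ψ)) (h' : Models X Y φ) :
    Models X Y ψ := fun e => (h e).resolve_left (not_not.2 (h' e))

theorem Derives.models {T : Set Formula} {φ : Formula} {X Y : Set ℕ} (h : Derives T φ)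
    (hT : ∀ ψ ∈ T, Models X Y ψ) : Models X Y φ := by
  induction h with
  | logic h => exact h.models X Y
  | hyp h => exact hT _ h
  | mp _ _ ih1 ih2 => exact ih1.mp ih2
  | gen v _ ih => exact fun e n => ih _

theorem not_models_neg {X Y : Set ℕ} {φ : Formula} (h : Models X Y φ) : ¬ Models X Y φ.neg :=
  fun h' => h' (fun _ => 0) (h _)

/-! ## The deduction theorem -/

namespace Derives

variable {T T' : Set Formula} {φ ψ χ : Formula}

theorem mono (hT : T ⊆ T') (h : Derives T φ) : Derives T' φ := by
  induction h with
  | logic h => exact .logic h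
  | hyp h => exact .hyp (hT h)
  | mp _ _ ih1 ih2 => exact .mp ih1 ih2
  | gen v _ ih => exact .gen v ih

theorem imp_intro (h : Derives T ψ) : Derives T (φ.imp ψ) :=
  .mp (.logic (.prop ψ φ φ _ (by simp [propAxioms, Formula.imp]))) h

theorem imp_mp (h1 : Derives T (φ.imp (ψ.imp χ))) (h2 : Derives T (φ.imp ψ)) :
    Derives T (φ.imp χ) :=
  .mp (.mp (.logic (.prop φ ψ χ _ (by simp [propAxioms, Formula.imp]))) h1) h2

theorem imp_refl (φ : Formula) : Derives T (φ.imp φ) :=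
  imp_mp (ψ := φ.imp φ) (.logic (.prop φ (φ.imp φ) φ _ (by simp [propAxioms, Formula.imp])))
    (.logic (.prop φ φ φ _ (by simp [propAxioms, Formula.imp])))

theorem imp_trans (h1 : Derives T (φ.imp ψ)) (h2 : Derives T (ψ.imp χ)) : Derives T (φ.imp χ) :=
  imp_mp (imp_intro h2) h1

theorem deduction (hφ : φ.IsSentence) (h : Derives (insert φ T) ψ) : Derives T (φ.imp ψ) := by
  induction h with
  | logic h => exact imp_intro (.logic h)
  | hyp h =>
    rcases h with rfl | h
    · exact imp_refl _
    · exact imp_intro (.hyp h)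
  | mp _ _ ih1 ih2 => exact imp_mp ih1 ih2
  | gen v _ ih =>
    -- Generalization under the hypothesis `φ` is harmless because `φ` is closed: `φ → ∀v φ` is an
    -- axiom.
    exact imp_trans (.logic (.allVac φ v (by rw [hφ]; simp)))
      (.mp (.logic (.allImp _ _ v)) (.gen v ih))

theorem neg_intro (h1 : Derives T (φ.imp ψ)) (h2 : Derives T (φ.imp ψ.neg)) : Derives T φ.neg :=
  .mp (.mp (.logic (.prop φ ψ φ _ (by simp [propAxioms, Formula.imp]))) h1) h2

theorem neg_neg (h : Derives T φ.neg.neg) : Derives T φ :=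
  .mp (.logic (.prop φ φ φ _ (by simp [propAxioms, Formula.imp]))) h

theorem cut (h : Derives (insert φ T) ψ) (hφ : Derives T φ) : Derives T ψ := by
  induction h with
  | logic h => exact .logic h
  | hyp h =>
    rcases h with rfl | h
    · exact hφ
    · exact .hyp h
  | mp _ _ ih1 ih2 => exact .mp ih1 ih2
  | gen v _ ih => exact .gen v ih

end Derives

/-! ## Sets of codes of sentences -/

/-- The formulas with codes in `Z`. -/
def decode (Z : Set ℕ) : Set Formula := {ψ | ψ.code ∈ Z}

theorem decode_mono {Z Z' : Set ℕ} (h : Z ⊆ Z') : decode Z ⊆ decode Z' := fun _ hψ => h hψ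

theorem decode_insert (φ : Formula) (Z : Set ℕ) :
    decode (insert φ.code Z) = insert φ (decode Z) := by
  ext ψ
  simp [decode, Formula.code_injective.eq_iff]

/-- Compactness for chains: the two premises of modus ponens are derivable from two members of the
chain, hence both from the larger one. -/
theorem derives_sUnion {c : Set (Set ℕ)} (hc : IsChain (· ⊆ ·) c) (hne : c.Nonempty)
    {φ : Formula} (h : Derives (decode (⋃₀ c)) φ) : ∃ Z ∈ c, Derives (decode Z) φ := by
  induction h with
  | logic h => exact ⟨_, hne.some_mem, .logic h⟩
  | hyp h =>
    obtain ⟨Z, hZ, h⟩ := h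
    exact ⟨Z, hZ, .hyp h⟩
  | mp _ _ ih1 ih2 =>
    obtain ⟨Z, hZ, h⟩ := ih1
    obtain ⟨Z', hZ', h'⟩ := ih2
    rcases hc.total hZ hZ' with hs | hs
    · exact ⟨Z', hZ', .mp (h.mono (decode_mono hs)) h'⟩
    · exact ⟨Z, hZ, .mp h (h'.mono (decode_mono hs))⟩
  | gen v _ ih =>
    obtain ⟨Z, hZ, h⟩ := ih
    exact ⟨Z, hZ, .gen v h⟩

theorem isConsistentSet_sUnion {c : Set (Set ℕ)} (hc : IsChain (· ⊆ ·) c) (hne : c.Nonempty)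
    (h : ∀ Z' ∈ c, IsConsistentSet Z') : IsConsistentSet (⋃₀ c) := by
  refine ⟨Set.sUnion_subset fun Z hZ => (h Z hZ).1, ?_⟩
  rintro ⟨φ, h1, h2⟩
  obtain ⟨Z, hZ, h1⟩ := derives_sUnion hc hne h1
  obtain ⟨Z', hZ', h2⟩ := derives_sUnion hc hne h2
  rcases hc.total hZ hZ' with hs | hs
  · exact (h Z' hZ').2 ⟨φ, h1.mono (decode_mono hs), h2⟩
  · exact (h Z hZ).2 ⟨φ, h1, h2.mono (decode_mono hs)⟩

/-- Lindenbaum's lemma. -/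
theorem IsConsistentSet.exists_maxCons {Y : Set ℕ} (hY : IsConsistentSet Y) :
    ∃ Z, Y ⊆ Z ∧ MaxCons Z :=
  zorn_subset_nonempty {Z | IsConsistentSet Z}
    (fun c hcs hc hne => ⟨⋃₀ c, isConsistentSet_sUnion hc hne fun _ hZ => hcs hZ,
      fun _ hs => Set.subset_sUnion_of_mem hs⟩) Y hY

/-- The interpretation `Y` of `Tr` need not be related to `Z`; a single structure in which `Z` is
true suffices. -/
theorem isConsistentSet_of_models {X Y Z : Set ℕ} (hZ : Z ⊆ SentCodes)
    (h : ∀ φ ∈ decode Z, Models X Y φ) : IsConsistentSet Z :=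
  ⟨hZ, fun ⟨_, h1, h2⟩ => not_models_neg (h1.models h) (h2.models h)⟩

theorem insert_subset_sentCodes {φ : Formula} {Z : Set ℕ} (hφ : φ.IsSentence)
    (hZ : Z ⊆ SentCodes) : insert φ.code Z ⊆ SentCodes :=
  Set.insert_subset ⟨φ, hφ, rfl⟩ hZ

theorem derives_neg_of_not_isConsistentSet_insert {Z : Set ℕ} {φ : Formula} (hφ : φ.IsSentence)
    (hZ : Z ⊆ SentCodes) (h : ¬ IsConsistentSet (insert φ.code Z)) :
    Derives (decode Z) φ.neg := by
  have : ∃ ψ, Derives (decode (insert φ.code Z)) ψ ∧ Derives (decode (insert φ.code Z)) ψ.neg := by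
    by_contra h'
    exact h ⟨insert_subset_sentCodes hφ hZ, h'⟩
  obtain ⟨ψ, h1, h2⟩ := this
  rw [decode_insert] at h1 h2
  exact .neg_intro (h1.deduction hφ) (h2.deduction hφ)

namespace MaxCons

variable {Z : Set ℕ} {φ : Formula}

theorem mem_of_derives (hZ : MaxCons Z) (hφ : φ.IsSentence) (h : Derives (decode Z) φ) :
    φ.code ∈ Z := by
  refine hZ.2 (y := insert φ.code Z) ⟨insert_subset_sentCodes hφ hZ.1.1, ?_⟩
    (Set.subset_insert _ _) (Set.mem_insert _ _)
  rintro ⟨ψ, h1, h2⟩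
  change Derives (decode _) _ at h1
  change Derives (decode _) _ at h2
  rw [decode_insert] at h1 h2
  exact hZ.1.2 ⟨ψ, h1.cut h, h2.cut h⟩

theorem neg_mem_iff (hZ : MaxCons Z) (hφ : φ.IsSentence) : φ.neg.code ∈ Z ↔ φ.code ∉ Z := by
  constructor
  · exact fun h h' => hZ.1.2 ⟨φ, .hyp h', .hyp h⟩
  · intro h
    refine hZ.mem_of_derives hφ (derives_neg_of_not_isConsistentSet_insert hφ hZ.1.1 fun hc => h ?_)
    exact hZ.2 hc (Set.subset_insert _ _) (Set.mem_insert _ _)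

end MaxCons

/-- If `Y` together with `¬φ` were consistent, Lindenbaum's lemma would extend it to a maximally
consistent set that omits `φ`. No term models are needed. -/
theorem derives_of_forall_maxCons {Y : Set ℕ} {φ : Formula}
    (hY : Y ⊆ SentCodes) (hφ : φ.IsSentence) (h : ∀ Z, Y ⊆ Z → MaxCons Z → φ.code ∈ Z) :
    Derives (decode Y) φ := by
  have hn : φ.neg.IsSentence := hφ
  refine (derives_neg_of_not_isConsistentSet_insert hn hY fun hc => ?_).neg_neg
  obtain ⟨Z, hYZ, hZ⟩ := hc.exists_maxCons
  exact (hZ.neg_mem_iff hφ).1 (hYZ (Set.mem_insert _ _))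
    (h Z ((Set.subset_insert _ _).trans hYZ) hZ)

/-! ## The stages -/

/-- A larger `Y` leaves fewer `Z` to be checked. -/
theorem jump_mono (X : Set ℕ) : Monotone (jump X) := by
  rintro Y Y' h n ⟨φ, hφ, rfl, hs⟩
  exact ⟨φ, hφ, rfl, fun Z hZ => hs Z (h.trans hZ)⟩

theorem stage_zero (X : Set ℕ) : stage X 0 = ∅ := Ordinal.limitRecOn_zero ..

theorem stage_succ (X : Set ℕ) (α : Ordinal.{0}) : stage X (α + 1) = jump X (stage X α) := by
  exact Ordinal.limitRecOn_add_one ..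

theorem stage_limit (X : Set ℕ) {l : Ordinal.{0}} (hl : Order.IsSuccLimit l) :
    stage X l = ⋃ (β : Ordinal.{0}) (_ : β < l), stage X β :=
  Ordinal.limitRecOn_limit _ _ _ _ hl

theorem stage_subset_limit (X : Set ℕ) {α l : Ordinal.{0}} (hl : Order.IsSuccLimit l)
    (h : α < l) : stage X α ⊆ stage X l := by
  rw [stage_limit X hl]
  exact Set.subset_iUnion₂_of_subset α h subset_rfl

theorem stage_subset_jump (X : Set ℕ) (α : Ordinal.{0}) : stage X α ⊆ jump X (stage X α) := by
  induction α using Ordinal.limitRecOn with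
  | zero => rw [stage_zero]; exact Set.empty_subset _
  | add_one α ih => rw [stage_succ]; exact jump_mono X ih
  | limit l hl ih =>
    conv_lhs => rw [stage_limit X hl]
    -- Each earlier stage lies in its own jump, and by monotonicity this jump lies in the jump of
    -- the limit stage.
    exact Set.iUnion₂_subset fun β hβ =>
      (ih β hβ).trans (jump_mono X (stage_subset_limit X hl hβ))

theorem stage_mono (X : Set ℕ) : Monotone (stage X) := by
  intro α β
  induction β using Ordinal.limitRecOn with
  | zero => intro h; rw [nonpos_iff_eq_zero.1 h]
  | add_one β ih =>
    intro h
    rcases h.eq_or_lt with rfl | h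
    · exact le_rfl
    · rw [stage_succ]
      exact (ih (Order.lt_add_one_iff.1 h)).trans (stage_subset_jump X β)
  | limit l hl _ =>
    intro h
    rcases h.eq_or_lt with rfl | h
    · exact le_rfl
    · exact stage_subset_limit X hl h

theorem exists_stage_eq (X : Set ℕ) : ∃ α : Ordinal.{0}, stage X α = stage X (α + 1) := by
  by_contra! h
  -- Two equal stages would squeeze the stage at `α + 1` between them; so without stabilisation the
  -- stages would inject the ordinals into `Set ℕ`.
  have hs : ∀ {α β : Ordinal.{0}}, α < β → stage X α ≠ stage X β := fun {α β} hαβ he =>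
    h α <| (stage_mono X (le_add_of_nonneg_right zero_le_one)).antisymm
      (he ▸ stage_mono X (Order.add_one_le_of_lt hαβ))
  refine not_injective_of_ordinal (stage X) fun α β he => ?_
  rcases lt_trichotomy α β with hαβ | hαβ | hαβ
  · exact absurd he (hs hαβ)
  · exact hαβ
  · exact absurd he.symm (hs hαβ)

theorem jump_subset_sentCodes (X Y : Set ℕ) : jump X Y ⊆ SentCodes := by
  rintro n ⟨φ, hφ, rfl, _⟩
  exact ⟨φ, hφ, rfl⟩

theorem code_mem_jump {X Y : Set ℕ} {φ : Formula} :
    φ.code ∈ jump X Y ↔ φ.IsSentence ∧ SatMC X Y φ := by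
  constructor
  · rintro ⟨ψ, hψ, h, hs⟩
    rw [← Formula.code_injective h]
    exact ⟨hψ, hs⟩
  · rintro ⟨hφ, hs⟩
    exact ⟨φ, hφ, rfl, hs⟩

/-- Any maximally consistent `Z ⊇ Y` supplies a structure `(ℕ, X, Z)` in which the whole jump is
true. -/
theorem IsConsistentSet.jump {X Y : Set ℕ} (hY : IsConsistentSet Y) :
    IsConsistentSet (jump X Y) := by
  obtain ⟨Z, hYZ, hZ⟩ := hY.exists_maxCons
  exact isConsistentSet_of_models (jump_subset_sentCodes X Y)
    fun φ hφ => (code_mem_jump.1 hφ).2 Z hYZ hZ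

theorem isConsistentSet_stage (X : Set ℕ) (α : Ordinal.{0}) : IsConsistentSet (stage X α) := by
  induction α using Ordinal.limitRecOn with
  | zero =>
    rw [stage_zero]
    exact isConsistentSet_of_models (X := ∅) (Y := ∅) (Set.empty_subset _) fun _ h => h.elim
  | add_one α ih => rw [stage_succ]; exact ih.jump
  | limit l hl ih =>
    have he : stage X l = ⋃₀ (stage X '' Set.Iio l) := by
      rw [stage_limit X hl, Set.sUnion_image]; rfl
    rw [he]
    refine isConsistentSet_sUnion ?_ ⟨_, 0, hl.bot_lt, rfl⟩ ?_
    · rintro _ ⟨β, _, rfl⟩ _ ⟨γ, _, rfl⟩ _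
      rcases le_total β γ with h | h
      · exact .inl (stage_mono X h)
      · exact .inr (stage_mono X h)
    · rintro _ ⟨β, hβ, rfl⟩
      exact ih β hβ

/-! ## Fixed points of the jump -/

/-- A consistent fixed point of the jump over `X`. -/
structure IsFixedPoint (X Y : Set ℕ) : Prop where
  consistent : IsConsistentSet Y
  jump_eq : jump X Y = Y

theorem isFixedPoint_stage {X : Set ℕ} {α : Ordinal.{0}} (h : stage X α = stage X (α + 1)) :
    IsFixedPoint X (stage X α) :=
  ⟨isConsistentSet_stage X α, by rw [← stage_succ, ← h]⟩

namespace IsFixedPoint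

variable {X Y : Set ℕ} {φ : Formula}

theorem code_mem_iff (hY : IsFixedPoint X Y) (hφ : φ.IsSentence) :
    φ.code ∈ Y ↔ SatMC X Y φ := by
  conv_lhs => rw [← hY.jump_eq]
  rw [code_mem_jump, and_iff_right hφ]

/-- Such a `φ` is derivable from `Y`. The members of `Y = jump X Y` are true in `(ℕ, X, Z)` for
every admissible `Z`, hence so is `φ`, which puts it into the jump. -/
theorem code_mem_of_forall_maxCons (hY : IsFixedPoint X Y) (hφ : φ.IsSentence)
    (h : ∀ Z, Y ⊆ Z → MaxCons Z → φ.code ∈ Z) : φ.code ∈ Y := by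
  have hd := derives_of_forall_maxCons hY.consistent.1 hφ h
  refine (hY.code_mem_iff hφ).2 fun Z hYZ hZ => hd.models fun ψ hψ => ?_
  have hψ' : ψ.code ∈ jump X Y := by rw [hY.jump_eq]; exact hψ
  exact (code_mem_jump.1 hψ').2 Z hYZ hZ

/-- The bridge between truth of `Tr(n)` under all admissible `Z` and membership in `Y`. That `n` is
the code of a sentence is read off from one extension, which exists by consistency. -/
theorem mem_iff_forall_maxCons (hY : IsFixedPoint X Y) (n : ℕ) :
    n ∈ Y ↔ ∀ Z, Y ⊆ Z → MaxCons Z → n ∈ Z := by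
  refine ⟨fun h Z hYZ _ => hYZ h, fun h => ?_⟩
  obtain ⟨Z, hYZ, hZ⟩ := hY.consistent.exists_maxCons
  obtain ⟨φ, hφ, rfl⟩ := hZ.1.1 (h Z hYZ hZ)
  exact hY.code_mem_of_forall_maxCons hφ h

/-- Membership of sentences whose truth does not depend on the interpretation of `Tr`. -/
theorem code_mem_iff_of_const (hY : IsFixedPoint X Y) (hφ : φ.IsSentence) {p : Prop}
    (h : ∀ Z, Models X Z φ ↔ p) : φ.code ∈ Y ↔ p := by
  rw [hY.code_mem_iff hφ]
  constructor
  · intro hs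
    obtain ⟨Z, hYZ, hZ⟩ := hY.consistent.exists_maxCons
    exact (h Z).1 (hs Z hYZ hZ)
  · exact fun hp Z _ _ => (h Z).2 hp

end IsFixedPoint

/-! ## Truth of the arithmetical formulas about codes -/

/-- All variables of `t` have an index below `k`. -/
def Term.Below (t : Term) (k : ℕ) : Prop := ∀ j ∈ t.vars, j < k

namespace Term.Below

theorem mono {t : Term} {k l : ℕ} (h : t.Below k) (hkl : k ≤ l) : t.Below l :=
  fun j hj => (h j hj).trans_le hkl

theorem var {i k : ℕ} (h : i < k) : (Term.var i).Below k := by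
  simpa [Term.Below, Term.vars] using h

@[simp] theorem var_iff {i k : ℕ} : (Term.var i).Below k ↔ i < k := by
  simp [Term.Below, Term.vars]

theorem tPair {s t : Term} {k : ℕ} (hs : s.Below k) (ht : t.Below k) : (tPair s t).Below k := by
  intro j hj
  rcases Finset.mem_union.1 hj with h | h
  · exact hs j h
  · exact ht j h

/-- The bound variables of the formulas about codes start at `v_k`, so evaluating their quantifiers
does not disturb the arguments. -/
theorem val_update {t : Term} {k i n : ℕ} {e : ℕ → ℕ} (h : t.Below k) (hki : k ≤ i) :
    t.val (Function.update e i n) = t.val e :=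
  Term.val_update fun hi => absurd (h i hi) (not_lt.2 hki)

end Term.Below

section Sat

variable {X Y : Set ℕ} {e : ℕ → ℕ} {k : ℕ}

theorem sat_imp {φ ψ : Formula} : (φ.imp ψ).Sat X Y e ↔ (φ.Sat X Y e → ψ.Sat X Y e) :=
  imp_iff_not_or.symm

theorem sat_iff {φ ψ : Formula} : (φ.iff ψ).Sat X Y e ↔ (φ.Sat X Y e ↔ ψ.Sat X Y e) := by
  simp only [Formula.iff, Formula.Sat, sat_imp, iff_iff_implies_and_implies]

theorem sat_bigOr {l : List Formula} : (bigOr l).Sat X Y e ↔ ∃ φ ∈ l, φ.Sat X Y e := by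
  induction l with
  | nil => simp [bigOr, Formula.Sat, Term.val, Fn1.interp]
  | cons φ l ih =>
    cases l with
    | nil => simp [bigOr]
    | cons ψ l => simp only [bigOr, Formula.Sat, List.exists_mem_cons_iff] at ih ⊢; rw [ih]

theorem sat_bigAnd {l : List Formula} : (bigAnd l).Sat X Y e ↔ ∀ φ ∈ l, φ.Sat X Y e := by
  induction l with
  | nil => simp [bigAnd, Formula.Sat]
  | cons φ l ih =>
    cases l with
    | nil => simp [bigAnd]
    | cons ψ l => simp only [bigAnd, Formula.Sat, List.forall_mem_cons] at ih ⊢; rw [ih]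

/-! ### Coded finite sets and the formation of terms and formulas -/

theorem sat_memF {s y : Term} : (memF s y).Sat X Y e ↔ (s.val e).testBit (y.val e) := by
  simp [memF, Formula.Sat, Term.val, Fn2.interp, tOne, tSucc, Fn1.interp]

theorem sat_closureF {x : Term} (hx : x.Below k) {step : Term → Term → Formula} :
    (closureF k x step).Sat X Y e ↔ ∃ s : ℕ, s.testBit (x.val e) ∧ ∀ y, s.testBit y →
      (step (.var k) (.var (k + 1))).Sat X Y
        (Function.update (Function.update e k s) (k + 1) y) := by
  simp [closureF, Formula.Sat, sat_memF, sat_imp, Term.val, hx.val_update]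

theorem sat_built1 {tag : ℕ} {s y : Term} (hs : s.Below k) (hy : y.Below k) :
    (built1 k tag s y).Sat X Y e ↔
      ∃ a, (s.val e).testBit a ∧ y.val e = Nat.pair tag a := by
  simp [built1, Formula.Sat, sat_memF, tPair, Term.val, Fn2.interp, hs.val_update, hy.val_update]

theorem sat_built2 {tag : ℕ} {s y : Term} (hs : s.Below k) (hy : y.Below k) :
    (built2 k tag s y).Sat X Y e ↔
      ∃ a b, (s.val e).testBit a ∧ (s.val e).testBit b ∧
        y.val e = Nat.pair tag (Nat.pair a b) := by
  simp [built2, Formula.Sat, sat_memF, sat_bigAnd, tPair, Term.val, Fn2.interp, hs.val_update,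
    hy.val_update]

theorem sat_built3 {tag : ℕ} {s y : Term} (hs : s.Below k) (hy : y.Below k) :
    (built3 k tag s y).Sat X Y e ↔
      ∃ a b c, (s.val e).testBit a ∧ (s.val e).testBit b ∧ (s.val e).testBit c ∧
        y.val e = Nat.pair tag (Nat.pair a (Nat.pair b c)) := by
  simp [built3, Formula.Sat, sat_memF, sat_bigAnd, tPair, Term.val, Fn2.interp, hs.val_update,
    hy.val_update]

theorem sat_varF {x : Term} (hx : x.Below k) :
    (varF k x).Sat X Y e ↔ ∃ i, codeVar i = x.val e := by
  simp [varF, Formula.Sat, tPair, tOne, tSucc, Term.val, Fn1.interp, Fn2.interp, hx.val_update,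
    codeVar, eq_comm]

/-- One step in the formation of closed terms from terms with codes in `M`. -/
def ClosedTermStep (M : ℕ → Prop) (y : ℕ) : Prop :=
  y = 0 ∨ (∃ f : Fn1, ∃ a, M a ∧ y = Nat.pair f.tag a) ∨
    (∃ f : Fn2, ∃ a b, M a ∧ M b ∧ y = Nat.pair f.tag (Nat.pair a b)) ∨
    ∃ a b c, M a ∧ M b ∧ M c ∧ y = Nat.pair 14 (Nat.pair a (Nat.pair b c))

theorem mem_allFn1 (f : Fn1) : f ∈ allFn1 := by cases f <;> simp [allFn1]

theorem mem_allFn2 (f : Fn2) : f ∈ allFn2 := by cases f <;> simp [allFn2]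

theorem sat_closedTermStep {s y : Term} (hs : s.Below k) (hy : y.Below k) :
    (closedTermStep k s y).Sat X Y e ↔
      ClosedTermStep (fun a => (s.val e).testBit a) (y.val e) := by
  simp [closedTermStep, ClosedTermStep, sat_bigOr, or_and_right, exists_or, sat_built1 hs hy,
    sat_built2 hs hy, sat_built3 hs hy, mem_allFn1, mem_allFn2, Formula.Sat, Term.val]

theorem lt_pair {a b c : ℕ} (ha : 0 < a) (h : c ≤ b) : c < Nat.pair a b := by
  have := Nat.add_le_pair a b
  omega

theorem Fn1.tag_pos (f : Fn1) : 0 < f.tag := by cases f <;> decide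

theorem Fn2.tag_pos (f : Fn2) : 0 < f.tag := by cases f <;> decide

/-- The property `p` is closedness for `ctF` and trivial for `termF`. Only members of `M` below `y`
matter, which fits strong induction on codes. -/
theorem exists_code_of_closedTermStep {M : ℕ → Prop} {y : ℕ} (p : Term → Prop)
    (hzero : p .zero) (h1 : ∀ f t, p t → p (.app1 f t)) (h2 : ∀ f s t, p s → p t → p (.app2 f s t))
    (h3 : ∀ s t u, p s → p t → p u → p (.sub s t u))
    (hM : ∀ a < y, M a → ∃ t : Term, p t ∧ t.code = a) (h : ClosedTermStep M y) :
    ∃ t : Term, p t ∧ t.code = y := by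
  rcases h with rfl | ⟨f, a, ha, rfl⟩ | ⟨f, a, b, ha, hb, rfl⟩ | ⟨a, b, c, ha, hb, hc, rfl⟩
  · exact ⟨.zero, hzero, rfl⟩
  · obtain ⟨t, ht, rfl⟩ := hM a (lt_pair f.tag_pos le_rfl) ha
    exact ⟨.app1 f t, h1 f t ht, rfl⟩
  · obtain ⟨s, hs, rfl⟩ := hM a (lt_pair f.tag_pos (Nat.left_le_pair _ _)) ha
    obtain ⟨t, ht, rfl⟩ := hM b (lt_pair f.tag_pos (Nat.right_le_pair _ _)) hb
    exact ⟨.app2 f s t, h2 f s t hs ht, rfl⟩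
  · obtain ⟨s, hs, rfl⟩ := hM a (lt_pair (by decide) (Nat.left_le_pair _ _)) ha
    obtain ⟨t, ht, rfl⟩ := hM b
      (lt_pair (by decide) ((Nat.left_le_pair _ _).trans (Nat.right_le_pair _ _))) hb
    obtain ⟨u, hu, rfl⟩ := hM c
      (lt_pair (by decide) ((Nat.right_le_pair _ _).trans (Nat.right_le_pair _ _))) hc
    exact ⟨.sub s t u, h3 s t u hs ht hu, rfl⟩

/-- Constituents have smaller codes than the whole, so membership in a finite set closed under
decomposition is well-founded and a term can be rebuilt by strong induction. -/
theorem exists_closed_of_sat_ctF {x : Term} (hx : x.Below k) (h : (ctF k x).Sat X Y e) :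
    ∃ t : Term, t.vars = ∅ ∧ t.code = x.val e := by
  obtain ⟨s, hs, hcl⟩ := (sat_closureF hx).1 h
  suffices H : ∀ y, s.testBit y → ∃ t : Term, t.vars = ∅ ∧ t.code = y from H _ hs
  intro y
  induction y using Nat.strong_induction_on with
  | _ y ih =>
    intro hy
    have h' := (sat_closedTermStep (.var (by omega)) (.var (by omega))).1 (hcl y hy)
    simp only [Term.val, ne_eq, Nat.left_eq_add, one_ne_zero, not_false_eq_true,
      Function.update_of_ne, Function.update_self] at h'
    exact exists_code_of_closedTermStep (fun t => t.vars = ∅) rfl (fun _ _ h => h)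
      (fun _ _ _ h h' => by simp [Term.vars, h, h'])
      (fun _ _ _ h h' h'' => by simp [Term.vars, h, h', h'']) ih h'

/-- Every finite set is the set of positions of the digits `1` of a number. -/
theorem exists_testBit_iff (S : Finset ℕ) : ∃ s : ℕ, ∀ i, s.testBit i = true ↔ i ∈ S := by
  induction S using Finset.induction_on with
  | empty => exact ⟨0, by simp⟩
  | insert a S _ ih =>
    obtain ⟨s, hs⟩ := ih
    exact ⟨2 ^ a ||| s, fun i => by
      simp only [Nat.testBit_or, Nat.testBit_two_pow, Bool.or_eq_true, decide_eq_true_eq, hs,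
        Finset.mem_insert, eq_comm (a := a)]⟩

/-- Supplies the witnesses for `closureF`: all codes of the relevant kind up to the given one form a
finite set that contains the constituents of its members. -/
theorem exists_testBit_iff_le (p : ℕ → Prop) (n : ℕ) :
    ∃ s : ℕ, ∀ i, s.testBit i = true ↔ i ≤ n ∧ p i := by
  classical
  obtain ⟨s, hs⟩ := exists_testBit_iff ((Finset.range (n + 1)).filter p)
  exact ⟨s, fun i => by rw [hs]; simp⟩

theorem Term.closedTermStep_code {M : ℕ → Prop} (t : Term)
    (hM : ∀ u : Term, u.code < t.code → M u.code) :
    (∃ i, codeVar i = t.code) ∨ ClosedTermStep M t.code := by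
  cases t with
  | var i => exact .inl ⟨i, rfl⟩
  | zero => exact .inr (.inl rfl)
  | app1 f t => exact .inr (.inr (.inl ⟨f, _, hM t (lt_pair f.tag_pos le_rfl), rfl⟩))
  | app2 f s t =>
    exact .inr (.inr (.inr (.inl ⟨f, _, _, hM s (lt_pair f.tag_pos (Nat.left_le_pair _ _)),
      hM t (lt_pair f.tag_pos (Nat.right_le_pair _ _)), rfl⟩)))
  | sub s t u =>
    exact .inr (.inr (.inr (.inr ⟨_, _, _, hM s (lt_pair (by decide) (Nat.left_le_pair _ _)),
      hM t (lt_pair (by decide) ((Nat.left_le_pair _ _).trans (Nat.right_le_pair _ _))),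
      hM u (lt_pair (by decide) ((Nat.right_le_pair _ _).trans (Nat.right_le_pair _ _))), rfl⟩)))

theorem sat_termF {x : Term} (hx : x.Below k) :
    (termF k x).Sat X Y e ↔ ∃ t : Term, t.code = x.val e := by
  have hstep : ∀ s y, ((varF (k + 2) (.var (k + 1))).or
      (closedTermStep (k + 2) (.var k) (.var (k + 1)))).Sat X Y
        (Function.update (Function.update e k s) (k + 1) y) ↔
      (∃ i, codeVar i = y) ∨ ClosedTermStep (fun a => s.testBit a) y := by
    intro s y
    simp only [Formula.Sat]
    rw [sat_varF (.var (by omega)), sat_closedTermStep (.var (by omega)) (.var (by omega))]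
    simp [Term.val]
  rw [termF, sat_closureF hx]
  simp only [hstep]
  constructor
  · rintro ⟨s, hs, hcl⟩
    suffices H : ∀ y, s.testBit y → ∃ t : Term, True ∧ t.code = y by simpa using H _ hs
    intro y
    induction y using Nat.strong_induction_on with
    | _ y ih =>
      intro hy
      rcases hcl y hy with ⟨i, rfl⟩ | h
      · exact ⟨.var i, trivial, rfl⟩
      · exact exists_code_of_closedTermStep (fun _ => True) trivial (fun _ _ h => h)
          (fun _ _ _ h _ => h) (fun _ _ _ h _ _ => h) ih h
  · rintro ⟨t, ht⟩
    obtain ⟨s, hs⟩ := exists_testBit_iff_le (fun n => ∃ t : Term, t.code = n) (x.val e)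
    refine ⟨s, (hs _).2 ⟨le_rfl, t, ht⟩, fun y hy => ?_⟩
    obtain ⟨hle, u, rfl⟩ := (hs _).1 hy
    exact u.closedTermStep_code fun r hr => (hs _).2 ⟨by omega, r, rfl⟩

/-- `y` is the code of an atomic formula. -/
def AtomCode (y : ℕ) : Prop :=
  (∃ s t : Term, y = (Formula.eq s t).code) ∨ (∃ t : Term, y = (Formula.tr t).code) ∨
    ∃ t : Term, y = (Formula.P t).code

theorem sat_atomF {y : Term} (hy : y.Below k) : (atomF k y).Sat X Y e ↔ AtomCode (y.val e) := by
  simp only [atomF, sat_bigOr, List.exists_mem_cons_iff, List.not_mem_nil, false_and, exists_false,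
    or_false, Formula.Sat, sat_bigAnd, List.forall_mem_cons, IsEmpty.forall_iff, implies_true,
    and_true, AtomCode]
  refine or_congr ?_ (or_congr ?_ ?_)
  · simp [sat_termF, Term.val, tEq, Fn2.interp, hy.val_update, Formula.code]
  · simp [sat_termF, Term.val, tPair, Fn2.interp, hy.val_update, Formula.code]
  · simp [sat_termF, Term.val, tPair, Fn2.interp, hy.val_update, Formula.code]

/-- One step in the formation of formulas from formulas with codes in `M`, with a condition on the
variables of quantification. -/
def FormulaStep (M C : ℕ → Prop) (y : ℕ) : Prop :=
  AtomCode y ∨ (∃ a, M a ∧ y = Nat.pair 18 a) ∨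
    (∃ a b, M a ∧ M b ∧ y = Nat.pair 19 (Nat.pair a b)) ∨
    (∃ a b, M a ∧ M b ∧ y = Nat.pair 20 (Nat.pair a b)) ∨
    ∃ i b, M b ∧ C (codeVar i) ∧ (y = Nat.pair 21 (Nat.pair (codeVar i) b) ∨
      y = Nat.pair 22 (Nat.pair (codeVar i) b))

theorem sat_builtQ {s y : Term} (hs : s.Below k) (hy : y.Below k) {cond : Term → Formula}
    {C : ℕ → Prop} (hC : ∀ a b, (cond (.var k)).Sat X Y
      (Function.update (Function.update e k a) (k + 1) b) ↔ C a) :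
    (builtQ k s y cond).Sat X Y e ↔
      ∃ i b, (s.val e).testBit b ∧ C (codeVar i) ∧
        (y.val e = Nat.pair 21 (Nat.pair (codeVar i) b) ∨
          y.val e = Nat.pair 22 (Nat.pair (codeVar i) b)) := by
  simp only [builtQ, Formula.Sat, sat_bigAnd, List.forall_mem_cons, IsEmpty.forall_iff,
    implies_true, and_true, hC, List.not_mem_nil]
  simp [sat_varF, sat_memF, Term.val, tAll, tEx, Fn2.interp, hy.val_update, hs.val_update]

theorem sat_formulaStep {s y : Term} (hs : s.Below k) (hy : y.Below k) {cond : Term → Formula}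
    {C : ℕ → Prop} (hC : ∀ a b, (cond (.var k)).Sat X Y
      (Function.update (Function.update e k a) (k + 1) b) ↔ C a) :
    (bigOr [atomF k y, built1 k 18 s y, built2 k 19 s y, built2 k 20 s y,
      builtQ k s y cond]).Sat X Y e ↔
      FormulaStep (fun a => (s.val e).testBit a) C (y.val e) := by
  simp [sat_bigOr, sat_atomF hy, sat_built1 hs hy, sat_built2 hs hy, sat_builtQ hs hy hC,
    FormulaStep]

theorem Formula.formulaStep_code {M : ℕ → Prop} (φ : Formula)
    (hM : ∀ ψ : Formula, ψ.code < φ.code → M ψ.code) :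
    FormulaStep M (fun _ => True) φ.code := by
  cases φ with
  | eq s t => exact .inl (.inl ⟨s, t, rfl⟩)
  | tr t => exact .inl (.inr (.inl ⟨t, rfl⟩))
  | P t => exact .inl (.inr (.inr ⟨t, rfl⟩))
  | neg φ => exact .inr (.inl ⟨_, hM φ (lt_pair (by decide) le_rfl), rfl⟩)
  | and φ ψ =>
    exact .inr (.inr (.inl ⟨_, _, hM φ (lt_pair (by decide) (Nat.left_le_pair _ _)),
      hM ψ (lt_pair (by decide) (Nat.right_le_pair _ _)), rfl⟩))
  | or φ ψ =>
    exact .inr (.inr (.inr (.inl ⟨_, _, hM φ (lt_pair (by decide) (Nat.left_le_pair _ _)),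
      hM ψ (lt_pair (by decide) (Nat.right_le_pair _ _)), rfl⟩)))
  | all v φ =>
    exact .inr (.inr (.inr (.inr ⟨v, _, hM φ (lt_pair (by decide) (Nat.right_le_pair _ _)),
      trivial, .inl rfl⟩)))
  | ex v φ =>
    exact .inr (.inr (.inr (.inr ⟨v, _, hM φ (lt_pair (by decide) (Nat.right_le_pair _ _)),
      trivial, .inr rfl⟩)))

theorem exists_code_of_formulaStep {M C : ℕ → Prop} {y : ℕ}
    (hM : ∀ a < y, M a → ∃ φ : Formula, φ.code = a) (h : FormulaStep M C y) :
    ∃ φ : Formula, φ.code = y := by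
  rcases h with (⟨s, t, rfl⟩ | ⟨t, rfl⟩ | ⟨t, rfl⟩) | ⟨a, ha, rfl⟩ | ⟨a, b, ha, hb, rfl⟩ |
    ⟨a, b, ha, hb, rfl⟩ | ⟨i, b, hb, -, rfl | rfl⟩
  · exact ⟨_, rfl⟩
  · exact ⟨_, rfl⟩
  · exact ⟨_, rfl⟩
  · obtain ⟨φ, rfl⟩ := hM a (lt_pair (by decide) le_rfl) ha
    exact ⟨.neg φ, rfl⟩
  · obtain ⟨φ, rfl⟩ := hM a (lt_pair (by decide) (Nat.left_le_pair _ _)) ha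
    obtain ⟨ψ, rfl⟩ := hM b (lt_pair (by decide) (Nat.right_le_pair _ _)) hb
    exact ⟨.and φ ψ, rfl⟩
  · obtain ⟨φ, rfl⟩ := hM a (lt_pair (by decide) (Nat.left_le_pair _ _)) ha
    obtain ⟨ψ, rfl⟩ := hM b (lt_pair (by decide) (Nat.right_le_pair _ _)) hb
    exact ⟨.or φ ψ, rfl⟩
  · obtain ⟨φ, rfl⟩ := hM b (lt_pair (by decide) (Nat.right_le_pair _ _)) hb
    exact ⟨.all i φ, rfl⟩
  · obtain ⟨φ, rfl⟩ := hM b (lt_pair (by decide) (Nat.right_le_pair _ _)) hb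
    exact ⟨.ex i φ, rfl⟩

theorem sat_forF {x : Term} (hx : x.Below k) :
    (forF k x).Sat X Y e ↔ ∃ φ : Formula, φ.code = x.val e := by
  rw [forF, sat_closureF hx]
  have hstep : ∀ s y, (bigOr [atomF (k + 2) (.var (k + 1)), built1 (k + 2) 18 (.var k) (.var (k + 1)),
      built2 (k + 2) 19 (.var k) (.var (k + 1)), built2 (k + 2) 20 (.var k) (.var (k + 1)),
      builtQ (k + 2) (.var k) (.var (k + 1)) (fun _ => .eq .zero .zero)]).Sat X Y
        (Function.update (Function.update e k s) (k + 1) y) ↔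
      FormulaStep (fun a => s.testBit a) (fun _ => True) y := by
    intro s y
    rw [sat_formulaStep (.var (by omega)) (.var (by omega)) (C := fun _ => True)
      (by simp [Formula.Sat])]
    simp [Term.val]
  simp only [hstep]
  constructor
  · rintro ⟨s, hs, hcl⟩
    suffices H : ∀ y, s.testBit y → ∃ φ : Formula, φ.code = y from H _ hs
    intro y
    induction y using Nat.strong_induction_on with
    | _ y ih => exact fun hy => exists_code_of_formulaStep ih (hcl y hy)
  · rintro ⟨φ, hφ⟩
    obtain ⟨s, hs⟩ := exists_testBit_iff_le (fun n => ∃ φ : Formula, φ.code = n) (x.val e)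
    refine ⟨s, (hs _).2 ⟨le_rfl, φ, hφ⟩, fun y hy => ?_⟩
    obtain ⟨hle, ψ, rfl⟩ := (hs _).1 hy
    exact ψ.formulaStep_code fun r hr => (hs _).2 ⟨by omega, r, rfl⟩

/-! ### Free variables, sentences and freedom for substitution -/

theorem sat_notFreeF {v x : Term} :
    (notFreeF v x).Sat X Y e ↔ substCode 0 (v.val e) (x.val e) = x.val e := Iff.rfl

theorem Formula.substCode_zero_code_eq_iff {φ : Formula} {i : ℕ} :
    substCode 0 (codeVar i) φ.code = φ.code ↔ i ∉ φ.fv := by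
  rw [show 0 = Term.zero.code from rfl, φ.substCode_code, Formula.code_injective.eq_iff]
  exact ⟨Formula.notMem_of_subst_zero, Formula.subst_of_notMem⟩

theorem Term.substCode_zero_code_eq_iff {t : Term} {i : ℕ} :
    substCode 0 (codeVar i) t.code = t.code ↔ i ∉ t.vars := by
  rw [show 0 = Term.zero.code from rfl, t.substCode_code, Term.code_injective.eq_iff]
  exact ⟨Term.notMem_of_subst_zero, Term.subst_of_notMem⟩

theorem sat_sentF {x : Term} (hx : x.Below k) :
    (sentF k x).Sat X Y e ↔ x.val e ∈ SentCodes := by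
  have h : (sentF k x).Sat X Y e ↔
      (∃ φ : Formula, φ.code = x.val e) ∧ ∀ i, substCode 0 (codeVar i) (x.val e) = x.val e := by
    simp only [sentF, Formula.Sat, sat_forF hx, sat_imp, sat_notFreeF]
    simp [sat_varF, Term.val, hx.val_update]
  rw [h]
  constructor
  · rintro ⟨⟨φ, hφ⟩, hc⟩
    simp only [← hφ, Formula.substCode_zero_code_eq_iff] at hc
    exact ⟨φ, Finset.eq_empty_of_forall_notMem hc, hφ⟩
  · rintro ⟨φ, hs, hφ⟩
    refine ⟨⟨φ, hφ⟩, fun i => ?_⟩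
    rw [← hφ, Formula.substCode_zero_code_eq_iff, hs]
    exact Finset.notMem_empty i

/-- Descent along the formula: where `vᵢ` is not free, nothing remains to be checked; otherwise the
tag selects the matching formation step, whose condition at a quantifier says that the bound
variable does not occur in `t`. -/
theorem Formula.freeFor_of_closed {M : ℕ → Prop} {t : Term} {i : ℕ}
    (h : ∀ y, M y → substCode 0 (codeVar i) y = y ∨
      FormulaStep M (fun w => substCode 0 w t.code = t.code) y) (φ : Formula) :
    M φ.code → φ.FreeFor t i := by
  have aux : ∀ φ : Formula, M φ.code → (FormulaStep M
      (fun w => substCode 0 w t.code = t.code) φ.code → φ.FreeFor t i) → φ.FreeFor t i := by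
    intro φ hφ hi
    rcases h _ hφ with h' | h'
    · exact Formula.freeFor_of_notMem (Formula.substCode_zero_code_eq_iff.1 h')
    · exact hi h'
  induction φ with
  | neg φ ih =>
    refine fun hφ => aux _ hφ fun hs => ?_
    -- The tag 18 rules out all alternatives but negation; the other connectives are treated
    -- likewise.
    simp [FormulaStep, AtomCode, Formula.code] at hs
    exact ih hs
  | and φ ψ ih ih' =>
    refine fun hφ => aux _ hφ fun hs => ?_
    simp [FormulaStep, AtomCode, Formula.code] at hs
    exact ⟨ih hs.1, ih' hs.2⟩
  | or φ ψ ih ih' =>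
    refine fun hφ => aux _ hφ fun hs => ?_
    simp [FormulaStep, AtomCode, Formula.code] at hs
    exact ⟨ih hs.1, ih' hs.2⟩
  | all v φ ih =>
    refine fun hφ => aux _ hφ fun hs => ?_
    simp [FormulaStep, AtomCode, Formula.code, codeVar_injective.eq_iff,
      Term.substCode_zero_code_eq_iff] at hs
    exact .inr ⟨hs.2, ih hs.1⟩
  | ex v φ ih =>
    refine fun hφ => aux _ hφ fun hs => ?_
    simp [FormulaStep, AtomCode, Formula.code, codeVar_injective.eq_iff,
      Term.substCode_zero_code_eq_iff] at hs
    exact .inr ⟨hs.2, ih hs.1⟩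
  | _ => exact fun _ => trivial

theorem freeFor_of_sat_freeForF {t v x : Term} (ht : t.Below k) (hv : v.Below k) (hx : x.Below k)
    {u : Term} {i : ℕ} {φ : Formula} (hu : u.code = t.val e) (hi : codeVar i = v.val e)
    (hφ : φ.code = x.val e) (h : (freeForF k t v x).Sat X Y e) : φ.FreeFor u i := by
  obtain ⟨s, hs, hcl⟩ := (sat_closureF hx).1 h
  refine Formula.freeFor_of_closed (M := fun a => s.testBit a) (fun y hy => ?_) φ (by rwa [hφ])
  have h' := hcl y hy
  -- Unfolding one layer of `bigOr` splits off `notFreeF`; the remaining list is that of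
  -- `sat_formulaStep`. The last side goal is that this list is nonempty.
  rw [bigOr, Formula.Sat, sat_formulaStep (.var (by omega)) (.var (by omega))
    (C := fun w => substCode 0 w (t.val e) = t.val e)
    (fun a b => by
      simp [notFreeF, Formula.Sat, Term.val, ht.val_update (show k ≤ k + 2 + 1 by omega),
        ht.val_update (show k ≤ k + 2 by omega), ht.val_update (Nat.le_succ k),
        ht.val_update le_rfl])] at h'
  · simpa [notFreeF, Formula.Sat, Term.val, hv.val_update, hu, hi] using h'
  · simp

/-- One step in the evaluation of closed terms. -/
def ValStep (M : ℕ → Prop) (p : ℕ) : Prop :=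
  p = Nat.pair 0 0 ∨
    (∃ f : Fn1, ∃ a b, M (Nat.pair a b) ∧ p = Nat.pair (Nat.pair f.tag a) (f.interp b)) ∨
    (∃ f : Fn2, ∃ a b a' b', M (Nat.pair a b) ∧ M (Nat.pair a' b') ∧
      p = Nat.pair (Nat.pair f.tag (Nat.pair a a')) (f.interp b b')) ∨
    ∃ a b a' b' a'' b'', M (Nat.pair a b) ∧ M (Nat.pair a' b') ∧ M (Nat.pair a'' b'') ∧
      p = Nat.pair (Nat.pair 14 (Nat.pair a (Nat.pair a' a''))) (substCode b' b'' b)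

theorem ValStep.mono {M M' : ℕ → Prop} (h : ∀ a, M a → M' a) {p : ℕ} (hp : ValStep M p) :
    ValStep M' p := by
  rcases hp with hp | ⟨f, a, b, h1, hp⟩ | ⟨f, a, b, a', b', h1, h2, hp⟩ |
    ⟨a, b, a', b', a'', b'', h1, h2, h3, hp⟩
  · exact .inl hp
  · exact .inr (.inl ⟨f, a, b, h _ h1, hp⟩)
  · exact .inr (.inr (.inl ⟨f, a, b, a', b', h _ h1, h _ h2, hp⟩))
  · exact .inr (.inr (.inr ⟨a, b, a', b', a'', b'', h _ h1, h _ h2, h _ h3, hp⟩))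

theorem exists_closed_of_valStep {M : ℕ → Prop} (hM : ∀ p, M p → ValStep M p) :
    ∀ x y, M (Nat.pair x y) → ∃ t : Term, t.vars = ∅ ∧ t.code = x ∧ t.val e = y := by
  intro x
  induction x using Nat.strong_induction_on with
  | _ x ih =>
    intro y hxy
    rcases hM _ hxy with hp | ⟨f, a, b, h1, hp⟩ | ⟨f, a, b, a', b', h1, h2, hp⟩ |
      ⟨a, b, a', b', a'', b'', h1, h2, h3, hp⟩
    all_goals obtain ⟨rfl, rfl⟩ := Nat.pair_eq_pair.1 hp
    · exact ⟨.zero, rfl, rfl, rfl⟩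
    · obtain ⟨t, ht, rfl, rfl⟩ := ih a (lt_pair f.tag_pos le_rfl) b h1
      exact ⟨.app1 f t, ht, rfl, rfl⟩
    · obtain ⟨s, hs, rfl, rfl⟩ := ih a (lt_pair f.tag_pos (Nat.left_le_pair _ _)) b h1
      obtain ⟨t, ht, rfl, rfl⟩ := ih a' (lt_pair f.tag_pos (Nat.right_le_pair _ _)) b' h2
      exact ⟨.app2 f s t, by simp [Term.vars, hs, ht], rfl, rfl⟩
    · obtain ⟨s, hs, rfl, rfl⟩ := ih a (lt_pair (by decide) (Nat.left_le_pair _ _)) b h1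
      obtain ⟨t, ht, rfl, rfl⟩ := ih a'
        (lt_pair (by decide) ((Nat.left_le_pair _ _).trans (Nat.right_le_pair _ _))) b' h2
      obtain ⟨u, hu, rfl, rfl⟩ := ih a''
        (lt_pair (by decide) ((Nat.right_le_pair _ _).trans (Nat.right_le_pair _ _))) b'' h3
      exact ⟨.sub s t u, by simp [Term.vars, hs, ht, hu], rfl, rfl⟩

/-- The set consists of the pairs of code and value for the subterms of `t`. -/
theorem exists_valStep_closed (e : ℕ → ℕ) (t : Term) (ht : t.vars = ∅) :
    ∃ S : Finset ℕ, Nat.pair t.code (t.val e) ∈ S ∧ ∀ p ∈ S, ValStep (· ∈ S) p := by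
  induction t with
  | var i => simp [Term.vars] at ht
  | zero => exact ⟨{Nat.pair 0 0}, by simp [Term.code, Term.val], fun p hp => .inl (by simpa using hp)⟩
  | app1 f t ih =>
    obtain ⟨S, hS, hcl⟩ := ih ht
    refine ⟨insert (Nat.pair (Term.app1 f t).code ((Term.app1 f t).val e)) S, by simp, fun p hp => ?_⟩
    rcases Finset.mem_insert.1 hp with rfl | hp
    · exact .inr (.inl ⟨f, _, _, Finset.mem_insert_of_mem hS, rfl⟩)
    · exact (hcl p hp).mono fun _ => Finset.mem_insert_of_mem
  | app2 f s t ih ih' =>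
    simp only [Term.vars, Finset.union_eq_empty] at ht
    obtain ⟨S, hS, hcl⟩ := ih ht.1
    obtain ⟨S', hS', hcl'⟩ := ih' ht.2
    refine ⟨insert (Nat.pair (Term.app2 f s t).code ((Term.app2 f s t).val e)) (S ∪ S'), by simp,
      fun p hp => ?_⟩
    simp only [Finset.mem_insert, Finset.mem_union] at hp
    rcases hp with rfl | hp | hp
    · exact .inr (.inr (.inl ⟨f, _, _, _, _, by simp [hS], by simp [hS'], rfl⟩))
    · exact (hcl p hp).mono fun _ h => by simp [h]
    · exact (hcl' p hp).mono fun _ h => by simp [h]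
  | sub s t u ih ih' ih'' =>
    simp only [Term.vars, Finset.union_eq_empty] at ht
    obtain ⟨S, hS, hcl⟩ := ih ht.1.1
    obtain ⟨S', hS', hcl'⟩ := ih' ht.1.2
    obtain ⟨S'', hS'', hcl''⟩ := ih'' ht.2
    refine ⟨insert (Nat.pair (Term.sub s t u).code ((Term.sub s t u).val e)) (S ∪ S' ∪ S''),
      by simp, fun p hp => ?_⟩
    simp only [Finset.mem_insert, Finset.mem_union, or_assoc] at hp
    rcases hp with rfl | hp | hp | hp
    · exact .inr (.inr (.inr ⟨_, _, _, _, _, _, by simp [hS], by simp [hS'], by simp [hS''], rfl⟩))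
    · exact (hcl p hp).mono fun _ h => by simp [h]
    · exact (hcl' p hp).mono fun _ h => by simp [h]
    · exact (hcl'' p hp).mono fun _ h => by simp [h]

/-- The assignment `e₀` is arbitrary, as values of closed terms do not depend on it. -/
theorem sat_valF {x y : Term} (hx : x.Below k) (hy : y.Below k) (e₀ : ℕ → ℕ) :
    (valF k x y).Sat X Y e ↔
      ∃ t : Term, t.vars = ∅ ∧ t.code = x.val e ∧ t.val e₀ = y.val e := by
  have h : (valF k x y).Sat X Y e ↔ ∃ s : ℕ, s.testBit (Nat.pair (x.val e) (y.val e)) ∧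
      ∀ p, s.testBit p → ValStep (fun a => s.testBit a) p := by
    rw [valF, sat_closureF (hx.tPair hy)]
    refine exists_congr fun s => and_congr Iff.rfl (forall_congr' fun p => imp_congr_right fun _ => ?_)
    simp [ValStep, sat_bigOr, sat_bigAnd, sat_memF, or_and_right, exists_or, mem_allFn1, mem_allFn2,
      Formula.Sat, Term.val, tPair, Fn2.interp]
  rw [h]
  constructor
  · rintro ⟨s, hs, hcl⟩
    exact exists_closed_of_valStep hcl _ _ hs
  · rintro ⟨t, ht, htx, hty⟩
    obtain ⟨S, hS, hcl⟩ := exists_valStep_closed e₀ t ht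
    obtain ⟨s, hs⟩ := exists_testBit_iff S
    rw [← htx, ← hty]
    exact ⟨s, (hs _).2 hS, fun p hp => (hcl p ((hs p).1 hp)).mono fun _ h => (hs _).2 h⟩

theorem sat_sameValF {x y : Term} (hx : x.Below k) (hy : y.Below k) {e₀ : ℕ → ℕ} {s t : Term}
    (hs : s.vars = ∅) (ht : t.vars = ∅) (hsx : s.code = x.val e) (hty : t.code = y.val e) :
    (sameValF k x y).Sat X Y e ↔ s.val e₀ = t.val e₀ := by
  simp only [sameValF, Formula.Sat,
    sat_valF (hx.mono (Nat.le_succ k)) (.var (Nat.lt_succ_self k)) e₀,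
    sat_valF (hy.mono (Nat.le_succ k)) (.var (Nat.lt_succ_self k)) e₀, hx.val_update le_rfl,
    hy.val_update le_rfl, ← hsx, ← hty, Term.code_injective.eq_iff]
  simp [Term.val, hs, ht, eq_comm]

end Sat

/-! ## Truth of the axioms of arithmetic -/

theorem testBit_zero_add_self (n : ℕ) : (n + n).testBit 0 = false := by
  simp [Nat.testBit_zero, ← two_mul]

theorem testBit_zero_succ_add_self (n : ℕ) : (n + n + 1).testBit 0 = true := by
  rw [Nat.testBit_zero]; simp; omega

theorem testBit_succ_add_self (n m : ℕ) : (n + n).testBit (m + 1) = n.testBit m := by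
  rw [Nat.testBit_succ]; congr 1; omega

theorem testBit_succ_succ_add_self (n m : ℕ) : (n + n + 1).testBit (m + 1) = n.testBit m := by
  rw [Nat.testBit_succ]; congr 1; omega

theorem models_of_mem_paAxioms {φ : Formula} (h : φ ∈ paAxioms) (X Y : Set ℕ) : Models X Y φ := by
  intro e
  simp only [paAxioms, List.mem_append, List.mem_cons, List.mem_map, List.not_mem_nil,
    or_false, or_assoc] at h
  rcases h with rfl | rfl | rfl | rfl | rfl | rfl | rfl | rfl | rfl | rfl | rfl | rfl | rfl | rfl |
    rfl | rfl | rfl | rfl | rfl | rfl | rfl | rfl | rfl | ⟨k, hk, rfl⟩ | ⟨k, hk, rfl⟩ | ⟨k, hk, rfl⟩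
  all_goals simp only [Formula.Sat, sat_imp, Term.val, tSucc, tPair, tOne, tNeg, tEq, tAnd, tOr,
    tAll, tEx, Fn1.interp, Fn2.interp, numeral_val, testBit_zero_add_self,
    testBit_zero_succ_add_self, testBit_succ_add_self, testBit_succ_succ_add_self]
  · omega
  · omega
  · rfl
  · rfl
  · rfl
  · rfl
  · intro h
    -- The premise `x + Sz = y` means `x < y`, the first case in the definition of `Nat.pair`; the
    -- premise `y + z = x` of the next axiom gives the other case.
    rw [Nat.pair, if_pos (by omega)]
  · intro h
    rw [Nat.pair, if_neg (by omega)]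
  · rfl
  · rfl
  · rfl
  · rfl
  · exact substCode_self _ _
  · exact fun h => substCode_14 h
  · intro h h'
    refine substCode_other h fun k hk hx => ?_
    -- If `x` had the tag `k`, its second component would violate the conjunct for `k`.
    have := sat_bigAnd.1 h' _ (List.mem_map_of_mem hk) (e 0).unpair.2
    simp [Formula.Sat, Term.val, Fn2.interp, ← hx] at this
  · exact fun h => substCode_tags1 hk h
  · exact fun h => substCode_tags2 hk h
  · refine fun h => ⟨fun h' => ?_, fun h' => ?_⟩
    · rw [substCode_tagsQ hk h, if_pos h']
    · rw [substCode_tagsQ hk h, if_neg h']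

/-! ## Truth of the axioms of Peano arithmetic in the extended language -/

/-- Since `propAxioms` is generic in the connectives, coding commutes with it: the codes of the
schemes at `A, B, C` are, in order, the values of the schemes at `a, b, c`. -/
theorem val_mem_map_code_propAxioms {e : ℕ → ℕ} {a b c p : Term} {A B C : Formula}
    (ha : A.code = a.val e) (hb : B.code = b.val e) (hc : C.code = c.val e)
    (hp : p ∈ propAxioms tNeg tAnd tOr a b c) :
    ∃ φ ∈ propAxioms Formula.neg Formula.and Formula.or A B C, φ.code = p.val e := by
  have h : (propAxioms Formula.neg Formula.and Formula.or A B C).map Formula.code =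
      (propAxioms tNeg tAnd tOr a b c).map (Term.val e) := by
    simp only [propAxioms, List.map_cons, List.map_nil, Formula.code, tNeg, tAnd, tOr, Term.val,
      Fn1.interp, Fn2.interp, ha, hb, hc]
  have h' : p.val e ∈ (propAxioms tNeg tAnd tOr a b c).map (Term.val e) :=
    List.mem_map_of_mem hp
  rw [← h] at h'
  simpa using h'

/-- The induction axiom for `A` and the variable `vᵢ`. -/
def indAx (A : Formula) (i : ℕ) : Formula :=
  (Formula.and (A.subst .zero i) (.all i (A.imp (A.subst (tSucc (.var i)) i)))).imp (.all i A)

theorem models_indAx (A : Formula) (i : ℕ) (X Y : Set ℕ) : Models X Y (indAx A i) := by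
  intro e
  simp only [indAx, sat_imp, Formula.Sat]
  rintro ⟨h0, hs⟩ n
  rw [A.sat_subst e (Formula.freeFor_of_vars_subset (Finset.empty_subset _))] at h0
  induction n with
  | zero => exact h0
  | succ n ih =>
    have := hs n ih
    rw [A.sat_subst _ (Formula.freeFor_of_vars_subset subset_rfl)] at this
    simpa [tSucc, Term.val, Fn1.interp] using this

/-- The conclusion concerns all interpretations, not just the given one, because VF2 requires truth
under every maximally consistent `Z`. -/
theorem exists_models_of_sat_axInstF {X Y : Set ℕ} {e : ℕ → ℕ} {k : ℕ} {y : Term}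
    (hy : y.Below k) (h : (axInstF k y).Sat X Y e) :
    ∃ φ : Formula, φ.code = y.val e ∧ ∀ X Y, Models X Y φ := by
  obtain ⟨a, b, c, v, s, t, h⟩ := h
  have hy' : y.val (Function.update (Function.update (Function.update (Function.update
      (Function.update (Function.update e k a) (k + 1) b) (k + 2) c) (k + 3) v) (k + 4) s)
      (k + 5) t) = y.val e := by
    iterate 6 rw [hy.val_update (by omega)]
  revert h hy'
  -- The assignment with the six witnesses `a, b, c, v, s, t` is used only through its values from
  -- here on.
  generalize he' : Function.update (Function.update (Function.update (Function.update
      (Function.update (Function.update e k a) (k + 1) b) (k + 2) c) (k + 3) v) (k + 4) s)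
      (k + 5) t = e'
  intro h hy'
  simp only [sat_bigAnd, List.forall_mem_cons] at h
  obtain ⟨hA, hB, hC, hv, hs, ht, h, -⟩ := h
  obtain ⟨A, hA⟩ := (sat_forF (.var (by omega))).1 hA
  obtain ⟨B, hB⟩ := (sat_forF (.var (by omega))).1 hB
  obtain ⟨C, hC⟩ := (sat_forF (.var (by omega))).1 hC
  obtain ⟨i, hi⟩ := (sat_varF (.var (by omega))).1 hv
  obtain ⟨s', hs⟩ := (sat_termF (.var (by omega))).1 hs
  obtain ⟨t', ht⟩ := (sat_termF (.var (by omega))).1 ht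
  have hfree : ∀ {x w : Term} {φ : Formula} {u : Term}, x.Below (k + 6) → w.Below (k + 6) →
      φ.code = x.val e' → u.code = w.val e' →
      (freeForF (k + 6) w (.var (k + 3)) x).Sat X Y e' → φ.FreeFor u i := fun hx hw hφ hu hf =>
    freeFor_of_sat_freeForF hw (.var (by omega)) hx hu hi hφ hf
  obtain ⟨ψ, hψ, hsat⟩ := sat_bigOr.1 h
  suffices H : ∃ φ : Formula, φ.code = y.val e' ∧ (LogAx φ ∨ φ ∈ paAxioms ∨ φ = indAx A i) by
    obtain ⟨φ, hφ, hl⟩ := H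
    refine ⟨φ, hφ.trans hy', fun X Y => ?_⟩
    rcases hl with hl | hl | rfl
    · exact hl.models X Y
    · exact models_of_mem_paAxioms hl X Y
    · exact models_indAx A i X Y
  simp only [List.mem_append, List.mem_map, List.mem_cons, List.not_mem_nil, or_false,
    or_assoc] at hψ
  simp only [Term.val] at hA hB hC hi hs ht
  have e0 : (0 : ℕ) = Term.zero.code := rfl
  -- `axInstF` spells out the code of `S v` as a pair with the tag of the successor symbol.
  have eS : Nat.pair 2 (codeVar i) = (tSucc (.var i)).code := rfl
  rcases hψ with ⟨p, hp, rfl⟩ | rfl | rfl | rfl | rfl | rfl | rfl | rfl | rfl | ⟨φ, hφ, rfl⟩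
  · obtain ⟨φ, hφ, hc⟩ := val_mem_map_code_propAxioms (e := e') hA hB hC hp
    exact ⟨φ, hc.trans hsat.symm, .inl (.prop A B C φ hφ)⟩
  · refine ⟨_, ?_, .inl (.allElim A i t' (hfree (.var (by omega)) (.var (by omega)) hA ht hsat.1))⟩
    rw [hsat.2]
    simp [tImp, tOr, tNeg, tAll, Term.val, Fn1.interp, Fn2.interp, ← hA, ← hi, ← ht,
      Formula.substCode_code, Formula.imp, Formula.code]
  · refine ⟨_, ?_, .inl (.exIntro A i t' (hfree (.var (by omega)) (.var (by omega)) hA ht hsat.1))⟩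
    rw [hsat.2]
    simp [tImp, tOr, tNeg, tEx, Term.val, Fn1.interp, Fn2.interp, ← hA, ← hi, ← ht,
      Formula.substCode_code, Formula.imp, Formula.code]
  · refine ⟨_, ?_, .inl (.allImp A B i)⟩
    rw [hsat]
    simp [tImp, tOr, tNeg, tAll, Term.val, Fn1.interp, Fn2.interp, ← hA, ← hB, ← hi,
      Formula.imp, Formula.code]
  · have hn : substCode 0 (e' (k + 3)) (e' k) = e' k := hsat.1
    rw [← hi, ← hA, Formula.substCode_zero_code_eq_iff] at hn
    refine ⟨_, ?_, .inl (.allVac A i hn)⟩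
    rw [hsat.2]
    simp [tImp, tOr, tNeg, tAll, Term.val, Fn1.interp, Fn2.interp, ← hA, ← hi,
      Formula.imp, Formula.code]
  · have hn : substCode 0 (e' (k + 3)) (e' (k + 1)) = e' (k + 1) := hsat.1
    rw [← hi, ← hB, Formula.substCode_zero_code_eq_iff] at hn
    refine ⟨_, ?_, .inl (.exElim A B i hn)⟩
    rw [hsat.2]
    simp [tImp, tOr, tNeg, tAll, tEx, Term.val, Fn1.interp, Fn2.interp, ← hA, ← hB, ← hi,
      Formula.imp, Formula.code]
  · refine ⟨_, ?_, .inl (.eqRefl t')⟩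
    rw [hsat]
    simp [tEq, Term.val, Fn2.interp, ← ht, Formula.code]
  · simp only [sat_bigAnd, List.forall_mem_cons] at hsat
    obtain ⟨hfs, hft, hsat, -⟩ := hsat
    refine ⟨_, ?_, .inl (.eqSubst A i s' t' (hfree (.var (by omega)) (.var (by omega)) hA hs hfs)
      (hfree (.var (by omega)) (.var (by omega)) hA ht hft))⟩
    rw [hsat]
    simp [tImp, tOr, tNeg, tEq, Term.val, Fn1.interp, Fn2.interp, ← hA, ← hi, ← hs, ← ht,
      Formula.substCode_code, Formula.imp, Formula.code]
  · refine ⟨_, ?_, .inr (.inr rfl)⟩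
    rw [hsat]
    simp only [tImp, tOr, tNeg, tAnd, tAll, tPair, Term.val, Fn1.interp, Fn2.interp, numeral_val,
      Fn1.tag, ← hA, ← hi, eS]
    rw [e0, Formula.substCode_code, Formula.substCode_code]
    rfl
  · exact ⟨φ, by rw [hsat, quote, numeral_val], .inr (.inl hφ)⟩

theorem exists_models_of_sat_axPATF {X Y : Set ℕ} {e : ℕ → ℕ} {k : ℕ} {x : Term}
    (hx : x.Below k) (h : (axPATF k x).Sat X Y e) :
    ∃ φ : Formula, φ.IsSentence ∧ φ.code = x.val e ∧ ∀ X Y, Models X Y φ := by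
  obtain ⟨h1, h2⟩ := h
  obtain ⟨φ, hφ, hφx⟩ := (sat_sentF hx).1 h1
  obtain ⟨s, hs, hcl⟩ := (sat_closureF hx).1 h2
  suffices H : ∀ y, s.testBit y → ∃ φ : Formula, φ.code = y ∧ ∀ X Y, Models X Y φ by
    obtain ⟨ψ, hψ, hm⟩ := H _ hs
    -- The formulas generalized along the way may be open; only the final one is identified with the
    -- sentence `φ`.
    rw [← hφx, Formula.code_injective.eq_iff] at hψ
    exact ⟨φ, hφ, hφx, hψ ▸ hm⟩
  intro y
  induction y using Nat.strong_induction_on with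
  | _ y ih =>
    intro hy
    rcases hcl y hy with h | h
    · obtain ⟨φ, hφ, hm⟩ := exists_models_of_sat_axInstF (.var (by omega)) h
      exact ⟨φ, by simpa [Term.val] using hφ, hm⟩
    · simp [Formula.Sat, sat_bigAnd, sat_varF, sat_memF, Term.val, tAll, Fn2.interp] at h
      obtain ⟨i, b, hb, rfl⟩ := h
      obtain ⟨φ, rfl, hm⟩ := ih b (lt_pair (by decide) (Nat.right_le_pair _ _)) hb
      exact ⟨.all i φ, rfl, fun X Y e n => hm X Y _⟩

/-! ## Truth of the axioms of truth in the fixed points -/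

theorem val_quoteDot (φ : Formula) (x : Term) (e : ℕ → ℕ) :
    (quoteDot φ x).val e = (φ.subst (numeral (x.val e)) 0).code := by
  rw [← Formula.substCode_code]
  simp [quoteDot, quote, quoteVar0, Term.val, Fn1.interp]

theorem Formula.isSentence_subst_numeral {φ : Formula} {i : ℕ} (h : φ.fv ⊆ {i}) (n : ℕ) :
    (φ.subst (numeral n) i).IsSentence := by
  rw [Formula.IsSentence, φ.fv_subst_of_closed (numeral_vars n), Finset.erase_eq_empty_iff]
  exact Finset.subset_singleton_iff.1 h

theorem Formula.models_subst_numeral {X Y : Set ℕ} {φ : Formula} {i n : ℕ} :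
    Models X Y (φ.subst (numeral n) i) ↔ ∀ e, φ.Sat X Y (Function.update e i n) := by
  refine forall_congr' fun e => ?_
  rw [φ.sat_subst e (Formula.freeFor_of_vars_subset (by simp)), numeral_val]

/-- The sentence `Tr(n)`. -/
def trNum (n : ℕ) : Formula := .tr (numeral n)

theorem isSentence_trNum (n : ℕ) : (trNum n).IsSentence := numeral_vars n

theorem models_trNum {X Z : Set ℕ} {n : ℕ} : Models X Z (trNum n) ↔ n ∈ Z := by
  simp [Models, trNum, Formula.Sat]

theorem val_quoteDot_tr (x : Term) (e : ℕ → ℕ) :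
    (quoteDot (.tr (.var 0)) x).val e = (trNum (x.val e)).code := by
  rw [val_quoteDot]; rfl

namespace IsFixedPoint

variable {X Y : Set ℕ} (hY : IsFixedPoint X Y)
include hY

theorem exists_isSentence {n : ℕ} (h : n ∈ Y) :
    ∃ φ : Formula, φ.IsSentence ∧ φ.code = n ∧ SatMC X Y φ := by
  rw [← hY.jump_eq] at h
  exact h

theorem code_trNum_mem_iff (n : ℕ) : (trNum n).code ∈ Y ↔ n ∈ Y := by
  rw [hY.code_mem_iff (isSentence_trNum n), hY.mem_iff_forall_maxCons n]
  simp only [SatMC, models_trNum]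

theorem models_VF1 : Models X Y VF1 := by
  intro e x y
  rw [sat_imp]
  rintro ⟨h1, h2⟩
  obtain ⟨s, hs, hsx⟩ := exists_closed_of_sat_ctF (.var (by omega)) h1
  obtain ⟨t, ht, hty⟩ := exists_closed_of_sat_ctF (.var (by omega)) h2
  have hv := sat_sameValF (X := X) (Y := Y) (k := 2) (.var (by omega)) (.var (by omega))
    (e₀ := e) hs ht hsx hty
  have hc : ∀ {u : Term}, u.vars = ∅ → ∀ e', u.val e' = u.val e := fun hu e' =>
    Term.val_congr _ fun j hj => by simp [hu] at hj
  have heq : ∀ Z, Models X Z (.eq s t) ↔ s.val e = t.val e := fun Z => by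
    simp [Models, Formula.Sat, hc hs, hc ht]
  have hne : ∀ Z, Models X Z (.neg (.eq s t)) ↔ ¬ s.val e = t.val e := fun Z => by
    simp [Models, Formula.Sat, hc hs, hc ht]
  have hst : (Formula.eq s t).IsSentence := by simp [Formula.IsSentence, Formula.fv, hs, ht]
  have e1 := hY.code_mem_iff_of_const hst heq
  have e2 := hY.code_mem_iff_of_const (φ := .neg (.eq s t)) hst hne
  refine ⟨?_, ?_⟩
  · rw [sat_iff, hv, ← e1]
    simp only [Formula.Sat, tEq, Term.val, Fn2.interp, Formula.code] at hsx hty ⊢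
    rw [hsx, hty]
  · rw [sat_iff, Formula.Sat, Formula.Sat, hv, ← e2]
    simp only [tNeg, tEq, Term.val, Fn1.interp, Fn2.interp, Formula.code] at hsx hty ⊢
    rw [hsx, hty]

theorem models_VF2 : Models X Y VF2 := by
  intro e x
  rw [sat_imp]
  intro h
  obtain ⟨φ, hφ, hx, hm⟩ := exists_models_of_sat_axPATF (.var (by omega)) h
  rw [Formula.Sat, ← hx, hY.code_mem_iff hφ]
  exact fun Z _ _ => hm X Z

/-- An ω-rule: every element of the domain is named by a numeral, so truth of all numerical
instances in `(ℕ, X, Z)` is truth of the generalization. -/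
theorem models_VF3 : Models X Y VF3 := by
  intro e x v
  rw [sat_imp, sat_imp, sat_varF (.var (by omega))]
  rintro ⟨i, hi⟩ h
  simp [Formula.Sat, Term.val, tAll, Fn1.interp, Fn2.interp] at h hi ⊢
  subst hi
  have hsent := fun n => hY.exists_isSentence (h n)
  -- The instance for `0` alone shows that `x` codes a formula and that this formula has at most
  -- `vᵢ` free.
  obtain ⟨ψ₀, -, hψ₀, -⟩ := hsent 0
  obtain ⟨φ, rfl⟩ := ψ₀.exists_code_of_substCode x hψ₀.symm
  simp only [Formula.substCode_code, Formula.code_injective.eq_iff] at hsent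
  have hfv : φ.fv ⊆ {i} := by
    obtain ⟨ψ, hψ, rfl, -⟩ := hsent 0
    rw [Formula.IsSentence, φ.fv_subst_of_closed (numeral_vars 0),
      Finset.erase_eq_empty_iff] at hψ
    exact Finset.subset_singleton_iff.2 hψ
  have hall : (Formula.all i φ).IsSentence := by
    rw [Formula.IsSentence, Formula.fv, Finset.erase_eq_empty_iff]
    exact Finset.subset_singleton_iff.1 hfv
  refine (hY.code_mem_iff hall).2 fun Z hYZ hZ e n => ?_
  obtain ⟨ψ, -, rfl, hs⟩ := hsent n
  exact Formula.models_subst_numeral.1 (hs Z hYZ hZ) e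

theorem models_VF4 : Models X Y VF4 := by
  intro e x
  rw [sat_iff, Formula.Sat, Formula.Sat, val_quoteDot_tr, hY.code_trNum_mem_iff]

/-- By maximality, `¬Tr(φ)` is true in `(ℕ, X, Z)` iff `¬φ ∈ Z`; then intersect over all `Z`. -/
theorem models_VF5 : Models X Y VF5 := by
  intro e x
  rw [sat_imp, sat_sentF (.var (by omega)), sat_iff]
  rintro ⟨φ, hφ, hx⟩
  have e1 : (trNum φ.code).neg.code ∈ Y ↔ φ.neg.code ∈ Y := by
    rw [hY.code_mem_iff (φ := (trNum φ.code).neg) (isSentence_trNum _),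
      hY.mem_iff_forall_maxCons φ.neg.code]
    refine forall_congr' fun Z => forall_congr' fun hYZ => forall_congr' fun hZ => ?_
    rw [hZ.neg_mem_iff hφ, ← models_trNum (X := X),
      ← (isSentence_trNum φ.code).sat_iff_models (fun _ => 0),
      ← Formula.IsSentence.sat_iff_models (φ := (trNum φ.code).neg) (isSentence_trNum φ.code)
        (fun _ => 0)]
    rfl
  simp only [Formula.Sat, tNeg, Term.val, Fn1.interp]
  rw [val_quoteDot_tr, ← hx]
  simp only [Term.val] at hx
  rw [← hx]
  exact e1

theorem models_VF6 : Models X Y VF6 := by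
  intro e x y
  simp [sat_imp, Formula.Sat, Term.val, tImp, tOr, tNeg, Fn1.interp, Fn2.interp]
  intro h1 h2
  obtain ⟨φ, hφ, hc, hs⟩ := hY.exists_isSentence h1
  obtain ⟨ψ, hψ, rfl, hs'⟩ := hY.exists_isSentence h2
  -- The tags force the coded sentence to be a disjunction and, at the second case split, its left
  -- member to be a negation.
  cases φ <;> simp [Formula.code] at hc
  rename_i φ χ
  obtain ⟨hc, rfl⟩ := hc
  cases φ <;> simp [Formula.code, Formula.code_injective.eq_iff] at hc
  subst hc
  simp only [Formula.IsSentence, Formula.fv, Finset.union_eq_empty] at hφ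
  exact (hY.code_mem_iff hφ.2).2 fun Z hYZ hZ => Models.mp (hs Z hYZ hZ) (hs' Z hYZ hZ)

theorem models_VF7 : Models X Y VF7 := by
  intro e x
  rw [sat_imp, sat_sentF (.var (by omega))]
  rintro ⟨φ, hφ, hx⟩
  rw [Formula.Sat, val_quoteDot, ← hx,
    hY.code_mem_iff (Formula.isSentence_subst_numeral (by decide) _)]
  refine fun Z _ hZ => Formula.models_subst_numeral.2 fun e => ?_
  rw [sat_iff]
  simpa [Formula.Sat, Term.val, tNeg, Fn1.interp, Formula.code] using (hZ.neg_mem_iff hφ).symm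

theorem models_VF8 : Models X Y VF8 := by
  intro e x
  rw [Formula.Sat, val_quoteDot,
    hY.code_mem_iff (Formula.isSentence_subst_numeral (by decide +kernel) _)]
  refine fun Z _ hZ => Formula.models_subst_numeral.2 fun e => ?_
  rw [sat_imp, sat_sentF (.var (by omega))]
  -- Here `sentF` occurs positively, so every code of a sentence must satisfy it.
  exact fun h => hZ.1.1 h

theorem models_PDisq : Models X Y PDisq := by
  intro e x
  rw [sat_iff, Formula.Sat, val_quoteDot]
  refine hY.code_mem_iff_of_const (Formula.isSentence_subst_numeral (by decide) _) fun Z => ?_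
  simp [Formula.models_subst_numeral, Formula.Sat, Term.val]

theorem models_of_mem_axiomsVFMStar {φ : Formula} (h : φ ∈ axiomsVFMStar) : Models X Y φ := by
  rcases h with ((h | h) | h) | h
  · exact models_of_mem_paAxioms h X Y
  · rw [h]
    -- `indP` is by computation the induction axiom for the formula `P(v₀)`.
    exact models_indAx (.P (.var 0)) 0 X Y
  · rcases h with rfl | rfl | rfl | rfl | rfl | rfl | rfl | rfl
    · exact hY.models_VF1
    · exact hY.models_VF2
    · exact hY.models_VF3
    · exact hY.models_VF4
    · exact hY.models_VF5
    · exact hY.models_VF6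
    · exact hY.models_VF7
    · exact hY.models_VF8
  · rw [h]
    exact hY.models_PDisq

end IsFixedPoint

/-! ### Soundness and consistency of the theory -/

theorem exists_isFixedPoint (X : Set ℕ) : ∃ Y, IsFixedPoint X Y :=
  let ⟨_, hα⟩ := exists_stage_eq X
  ⟨_, isFixedPoint_stage hα⟩

/-- The sets `X` and `Y` are quantified inside the induction because P-Subst changes both. -/
theorem VFMStar.models {φ : Formula} (h : VFMStar φ) :
    ∀ {X Y : Set ℕ}, IsFixedPoint X Y → Models X Y φ := by
  induction h with
  | logic h => exact fun _ => h.models _ _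
  | nonlogical h => exact fun hY => hY.models_of_mem_axiomsVFMStar h
  | mp _ _ ih1 ih2 => exact fun hY => (ih1 hY).mp (ih2 hY)
  | gen v _ ih => exact fun hY e n => ih hY _
  | pSubst B i hA hcap _ ih =>
    intro X Y hY e
    -- Any fixed point over the set defined by `B` will do, since `A` does not contain `Tr`.
    obtain ⟨Y', hY'⟩ := exists_isFixedPoint {n | B.Sat X Y (Function.update e i n)}
    exact (Formula.sat_substP _ e hA hcap).2 (ih hY' e)

end VFM

theorem mainTheorem12 :
    (∀ X : Set ℕ,
      (∃ α : Ordinal.{0}, VFM.stage X α = VFM.stage X (α + 1)) ∧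
      ∀ α : Ordinal.{0}, VFM.stage X α = VFM.stage X (α + 1) →
        ∀ φ : VFM.Formula, VFM.VFMStar φ → VFM.Models X (VFM.stage X α) φ) ∧
    ¬ ∃ φ : VFM.Formula, VFM.VFMStar φ ∧ VFM.VFMStar (VFM.Formula.neg φ) := by
  refine ⟨fun X => ⟨VFM.exists_stage_eq X, fun α hα φ h => h.models (VFM.isFixedPoint_stage hα)⟩, ?_⟩
  rintro ⟨φ, h1, h2⟩
  obtain ⟨Y, hY⟩ := VFM.exists_isFixedPoint ∅
  exact VFM.not_models_neg (h1.models hY) (h2.models hY)
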